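/- All digraphs are finite and have neither loops nor parallel arcs, but two opposite arcs $uv$ and $vu$ are allowed. A digraph is connected if it is non-empty and its underlying undirected graph is connected. A separating vertex of a connected digraph $B$ is a vertex $v$ such that $B-v$ is disconnected (the vertex of a one-vertex digraph is not separating), and a block of a digraph $D$ is a maximal connected subdigraph of $D$ that has no separating vertex. A cover of a digraph $D$ is a pair $(X,H)$, where $H$ is a digraph and $X$ assigns to each $v\in V(D)$ a set $X_v\subseteq V(H)$, such that the sets $X_v$ are pairwise disjoint, have union $V(H)$, and are independent in $H$; for each arc $uv$ of $D$ the arcs of $H$ from $X_u$ to $X_v$ form a (possibly empty) matching, i.e. no two of them share an end-vertex; and each arc of $H$ goes from $X_u$ to $X_v$ for some arc $uv$ of $D$. The digraph $D$ is $(X,H)$-colorable if there is a set $T\subseteq V(H)$ with $|T\cap X_v|=1$ for all $v\in V(D)$ such that the induced subdigraph $H[T]$ contains no directed cycle (of length $\ge 2$, digons included). The digraph $D$ is DP-degree-colorable if it is $(X,H)$-colorable for every cover $(X,H)$ of $D$ with $|X_v|\ge\max\{d_D^+(v),d_D^-(v)\}$ for all $v\in V(D)$. **Theorem.** A connected digraph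 $D$ is not DP-degree-colorable if and only if for every block $B$ of $D$ one of the following cases occurs: (a) $B$ is a directed cycle of length $\ge 2$; (b) $B$ is a bidirected cycle of length $\ge 3$; (c) $B$ is a bidirected complete graph (possibly a single vertex). Here a bidirected graph is a digraph obtained from a simple undirected graph by replacing each edge by two opposite arcs. -/

import Mathlib

universe u w

namespace Digraph

/-- A digraph without loops. (Parallel arcs do not exist in a `Digraph`; opposite arcs may.) -/
def Loopless {V : Type*} (D : Digraph V) : Prop := ∀ v, ¬ D.Adj v v

/-- The set of out-neighbors of `v`. -/
def outNeighbors {V : Type*} (D : Digraph V) (v : V) : Set V := {w | D.Adj v w}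

/-- The set of in-neighbors of `v`. -/
def inNeighbors {V : Type*} (D : Digraph V) (v : V) : Set V := {u | D.Adj u v}

/-- The out-degree of `v`; used for finite digraphs only. -/
noncomputable def outDegree {V : Type*} (D : Digraph V) (v : V) : ℕ := (D.outNeighbors v).ncard

/-- The in-degree of `v`; used for finite digraphs only. -/
noncomputable def inDegree {V : Type*} (D : Digraph V) (v : V) : ℕ := (D.inNeighbors v).ncard

/-- The subdigraph of `D` induced by the vertex set `S`, as a digraph with vertex set `S`. -/
def induce {V : Type*} (D : Digraph V) (S : Set V) : Digraph S where
  Adj x y := D.Adj x y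

/-- A digraph is (weakly) connected if its underlying simple graph is connected
(in particular it has a vertex). -/
def IsConnected {V : Type*} (D : Digraph V) : Prop := D.toSimpleGraphInclusive.Connected

/-- `v` is a separating vertex of `D` if `D - v` is disconnected, that is, `D - v` has two vertices
that are not joined by a path of its underlying graph. As usual, the vertex of a one-vertex digraph
is not separating. -/
def IsSeparatingVertex {V : Type*} (D : Digraph V) (v : V) : Prop :=
  ¬ (D.induce {v}ᶜ).toSimpleGraphInclusive.Preconnected

/-- `D` is a directed cycle of length `p ≥ 2`: its vertices are the distinct `c i` with `i ∈ ℤ/p`,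
and its arcs are those from `c i` to `c (i + 1)`. -/
def IsDirectedCycle {V : Type*} (D : Digraph V) : Prop :=
  ∃ p : ℕ, 2 ≤ p ∧ ∃ c : ZMod p ≃ V, ∀ i j, D.Adj (c i) (c j) ↔ j = i + 1

/-- The bidirected graph `D(G)`: each edge of `G` is replaced by two opposite arcs. -/
def ofSimpleGraph {V : Type*} (G : SimpleGraph V) : Digraph V where
  Adj := G.Adj

/-- `D` is a bidirected cycle of length `p ≥ 3`: it is `D(G)` for a cycle `G` of length `p`. -/
def IsBidirectedCycle {V : Type*} (D : Digraph V) : Prop :=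
  ∃ G : SimpleGraph V, D = ofSimpleGraph G ∧
    ∃ p : ℕ, 3 ≤ p ∧ Nonempty (SimpleGraph.cycleGraph p ≃g G)

/-- `D` is a bidirected complete graph: it is `D(G)` for the complete graph `G` on its vertices. -/
def IsBidirectedComplete {V : Type*} (D : Digraph V) : Prop :=
  D = ofSimpleGraph (⊤ : SimpleGraph V)

/-- A subdigraph of `D`: a set of vertices and a set of arcs of `D` with ends among them. -/
@[ext]
structure Subdigraph {V : Type*} (D : Digraph V) where
  verts : Set V
  Adj : V → V → Prop
  adj_sub : ∀ {x y : V}, Adj x y → D.Adj x y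
  left_mem : ∀ {x y : V}, Adj x y → x ∈ verts
  right_mem : ∀ {x y : V}, Adj x y → y ∈ verts

/-- `A ≤ B` means that `A` is a subdigraph of `B`. -/
instance {V : Type*} (D : Digraph V) : PartialOrder (Subdigraph D) where
  le A B := A.verts ⊆ B.verts ∧ ∀ x y, A.Adj x y → B.Adj x y
  le_refl A := ⟨subset_rfl, fun _ _ h => h⟩
  le_trans A B C h₁ h₂ := ⟨h₁.1.trans h₂.1, fun x y h => h₂.2 x y (h₁.2 x y h)⟩
  le_antisymm A B h₁ h₂ := by
    apply Subdigraph.ext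
    · exact h₁.1.antisymm h₂.1
    · funext x y
      exact propext ⟨h₁.2 x y, h₂.2 x y⟩

/-- A subdigraph, as a digraph in its own right. -/
def Subdigraph.toDigraph {V : Type*} {D : Digraph V} (B : Subdigraph D) : Digraph B.verts where
  Adj x y := B.Adj x y

/-- A block of `D`: a maximal connected subdigraph that has no separating vertex. -/
def IsBlock {V : Type*} (D : Digraph V) (B : Subdigraph D) : Prop :=
  Maximal (fun A : Subdigraph D =>
    A.toDigraph.IsConnected ∧ ∀ v, ¬ A.toDigraph.IsSeparatingVertex v) B

/-- `D` contains no directed cycle (as a subdigraph). -/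
def IsAcyclic {V : Type*} (D : Digraph V) : Prop :=
  ∀ C : Subdigraph D, ¬ C.toDigraph.IsDirectedCycle

/-- The set `E_D(S, T)` of the arcs with initial vertex in `S` and terminal vertex in `T`. -/
def arcsBetween {V : Type*} (D : Digraph V) (S T : Set V) : Set (V × V) :=
  {a | a.1 ∈ S ∧ a.2 ∈ T ∧ D.Adj a.1 a.2}

/-- A set of arcs is a matching if no two of its arcs have a common end-vertex. -/
def IsMatching {V : Type*} (M : Set (V × V)) : Prop :=
  ∀ a ∈ M, ∀ b ∈ M, a ≠ b → a.1 ≠ b.1 ∧ a.1 ≠ b.2 ∧ a.2 ≠ b.1 ∧ a.2 ≠ b.2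

/-- A cover `(X, H)` of `D`, where `H` is a digraph with vertex set `W`: the sets `X v` are pairwise
disjoint, have union `W`, and are independent in `H`; for each arc `u v` of `D`, the arcs of `H`
from `X u` to `X v` form a (possibly empty) matching, and each arc of `H` is of this kind. -/
structure Cover {V : Type*} (D : Digraph V) (W : Type*) where
  X : V → Finset W
  H : Digraph W
  disjoint : ∀ u v, u ≠ v → Disjoint (X u) (X v)
  exhaust : ∀ x : W, ∃ v, x ∈ X v
  independent : ∀ v, ∀ x ∈ X v, ∀ y ∈ X v, ¬ H.Adj x y
  matching : ∀ u v, D.Adj u v → IsMatching (H.arcsBetween (X u) (X v))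
  arcs : ∀ x y, H.Adj x y → ∃ u v, D.Adj u v ∧ x ∈ X u ∧ y ∈ X v

/-- `T` is a transversal: it has exactly one element in each `X v`. -/
def Cover.IsTransversal {V W : Type*} {D : Digraph V} (K : Cover D W) (T : Set W) : Prop :=
  ∀ v, ∃! x, x ∈ T ∧ x ∈ K.X v

/-- `D` is `(X, H)`-colorable: there is a transversal `T` such that `H[T]` contains no
directed cycle. -/
def Cover.IsColorable {V W : Type*} {D : Digraph V} (K : Cover D W) : Prop :=
  ∃ T : Set W, K.IsTransversal T ∧ (K.H.induce T).IsAcyclic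

/-- `D` is DP-`f`-colorable: `D` is `(X, H)`-colorable for each cover `(X, H)` of `D` such that
`|X v| ≥ f v` for all `v`. -/
def IsDPColorable {V : Type u} (D : Digraph V) (f : V → ℕ) : Prop :=
  ∀ (W : Type w) (K : Cover D W), (∀ v, f v ≤ (K.X v).card) → K.IsColorable

/-- `D` is DP-degree-colorable. -/
def IsDPDegreeColorable {V : Type u} (D : Digraph V) : Prop :=
  IsDPColorable.{u, w} D (fun v => max (D.outDegree v) (D.inDegree v))

end Digraph

/-! Having a bad cover, one with large enough lists and no acyclic coloring, is compatible with
gluing at a cut vertex v. Given a bad cover of a union, color one piece greedily off v and keep only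
the colors of v that extend acyclically: what remains is bad on the other piece
(`Uncolorable.left`). Bad covers of two pieces add up to one of the union (`Uncolorable.union`).
This reduces the theorem to nonseparable digraphs. The three kinds of bricks have explicit bad
covers.

Conversely, take a bad cover of a nonseparable digraph with at least two vertices (`Obstruction`).
Greedy coloring reaches all vertices but a prescribed v. Each color of v then has an arc to a chosen
color, since otherwise it would make v a sink. There are at least as many colors as out-neighbors,
so the two correspond bijectively (`exists_out_map`), and likewise for in-neighbors. Hence all lists
and all degrees have one size k, and the uncolored vertex can be moved along the arcs of the chosen
colors.

If k = 1, the digraph is a directed cycle. If k is at least 2, freezing a path of a colored cycle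
while the uncolored vertex travels around it shows that the digraph is bidirected
(`symm_of_two_le`). For k = 2 it is then a bidirected cycle. For k at least 3 and a noncomplete
digraph, an argument in the style of Brooks' theorem gives v with nonadjacent neighbors a, b whose
removal leaves a connected digraph (`exists_nonadjacent_pair`). Coloring a and b so that both meet
the same color of v breaks the bijection (`not_conn_compl_pair`). -/

namespace DPDegree

open Set

/-! ### Acyclicity as existence of sinks -/

section Acyclic

variable {V : Type*}

/-- Every nonempty subset of `S` has a vertex without out-neighbors in it. -/
def Acyc (R : V → V → Prop) (S : Set V) : Prop :=
  ∀ A ⊆ S, A.Nonempty → ∃ a ∈ A, ∀ b ∈ A, ¬ R a b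

theorem Acyc.mono {R : V → V → Prop} {S T : Set V} (h : Acyc R T) (hST : S ⊆ T) : Acyc R S :=
  fun A hA => h A (hA.trans hST)

theorem Acyc.congr {R R' : V → V → Prop} {S : Set V} (h : Acyc R S)
    (hR : ∀ a ∈ S, ∀ b ∈ S, R' a b → R a b) : Acyc R' S := by
  intro A hA hne
  obtain ⟨a, ha, h1⟩ := h A hA hne
  exact ⟨a, ha, fun b hb hab => h1 b hb (hR a (hA ha) b (hA hb) hab)⟩

theorem acyc_empty (R : V → V → Prop) : Acyc R ∅ := by
  intro A hA hne
  obtain ⟨a, ha⟩ := hne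
  exact absurd (hA ha) (notMem_empty a)

/-- Remove a sink and take a source of the rest: it is a source of the whole. This symmetry lets
every statement about out-arcs be reused for in-arcs. -/
theorem Acyc.flip [Finite V] {R : V → V → Prop} {S : Set V} (h : Acyc R S) :
    Acyc (fun a b => R b a) S := by
  have key : ∀ n : ℕ, ∀ A ⊆ S, A.ncard = n → A.Nonempty → ∃ a ∈ A, ∀ b ∈ A, ¬ R b a := by
    intro n
    induction n with
    | zero =>
      intro A _ hc hne
      exact absurd ((ncard_eq_zero A.toFinite).1 hc) hne.ne_empty
    | succ n ih =>
      intro A hA hc hne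
      obtain ⟨s, hs, h1⟩ := h A hA hne
      by_cases he : (A \ {s}).Nonempty
      · obtain ⟨r, hr, h2⟩ := ih (A \ {s}) (sdiff_subset.trans hA)
          (by rw [ncard_sdiff_singleton_of_mem hs, hc]; rfl) he
        refine ⟨r, hr.1, fun b hb => ?_⟩
        by_cases hbs : b = s
        · subst hbs; exact h1 r hr.1
        · exact h2 b ⟨hb, hbs⟩
      · refine ⟨s, hs, fun b hb => ?_⟩
        have : b = s := by
          by_contra hbs
          exact he ⟨b, hb, hbs⟩
        subst this
        exact h1 b hb
  exact fun A hA hne => key _ A hA rfl hne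

theorem Acyc.insert_of_no_out {R : V → V → Prop} {S : Set V} (h : Acyc R S) {x : V}
    (hxx : ¬ R x x) (hx : ∀ y ∈ S, ¬ R x y) : Acyc R (insert x S) := by
  intro A hA hne
  by_cases hxA : x ∈ A
  · refine ⟨x, hxA, fun b hb => ?_⟩
    rcases hA hb with rfl | hbS
    · exact hxx
    · exact hx b hbS
  · exact h A (fun a ha => (hA ha).resolve_left (fun e => hxA (e ▸ ha))) hne

/-- Acyclic relations on two sets that share one vertex, without arcs between the remainders. -/
theorem Acyc.union {R : V → V → Prop} {S T : Set V} {v : V} (hS : Acyc R S) (hT : Acyc R T)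
    (hvS : v ∈ S) (hvT : v ∈ T)
    (hST : ∀ a ∈ S, ∀ b ∈ T, a ≠ v → b ≠ v → ¬ R a b)
    (hTS : ∀ a ∈ T, ∀ b ∈ S, a ≠ v → b ≠ v → ¬ R a b) : Acyc R (S ∪ T) := by
  intro A hA hne
  by_contra! hcon
  -- A sink of A ∩ S other than v would be a sink of A, so the sink is v. Applied to both sides,
  -- this makes v a sink of A.
  have aux : ∀ S T : Set V, Acyc R S → v ∈ S →
      (∀ a ∈ S, ∀ b ∈ T, a ≠ v → b ≠ v → ¬ R a b) → A ⊆ S ∪ T → (A ∩ S).Nonempty →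
      v ∈ A ∧ ∀ b ∈ A ∩ S, ¬ R v b := by
    intro S T hS hvS hST hA hne
    obtain ⟨s, hs, h1⟩ := hS (A ∩ S) inter_subset_right hne
    by_cases hsv : s = v
    · subst hsv
      exact ⟨hs.1, h1⟩
    · obtain ⟨b, hb, hsb⟩ := hcon s hs.1
      by_cases hbS : b ∈ S
      · exact absurd hsb (h1 b ⟨hb, hbS⟩)
      · have hbT := (hA hb).resolve_left hbS
        exact absurd hsb (hST s hs.2 b hbT hsv (fun e => hbS (e ▸ hvS)))
  have hvA : v ∈ A := by
    obtain ⟨a, ha⟩ := hne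
    rcases hA ha with h | h
    · exact (aux S T hS hvS hST hA ⟨a, ha, h⟩).1
    · exact (aux T S hT hvT hTS (by rwa [union_comm]) ⟨a, ha, h⟩).1
  have h1 := (aux S T hS hvS hST hA ⟨v, hvA, hvS⟩).2
  have h2 := (aux T S hT hvT hTS (by rwa [union_comm]) ⟨v, hvA, hvT⟩).2
  obtain ⟨b, hb, hvb⟩ := hcon v hvA
  rcases hA hb with h | h
  · exact h1 b ⟨hb, h⟩ hvb
  · exact h2 b ⟨hb, h⟩ hvb

end Acyclic

/-! ### Connectivity expressed through cuts -/

section Connectivity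

variable {V : Type*}

/-- No proper nonempty part of `S` is without an edge to the rest of `S`. -/
def CutConn (r : V → V → Prop) (S : Set V) : Prop :=
  ∀ A ⊆ S, A.Nonempty → (S \ A).Nonempty → ∃ a ∈ A, ∃ b ∈ S \ A, r a b

/-- For cut-connectivity it suffices to consider the parts that miss a given vertex. -/
theorem CutConn.of_notMem {r : V → V → Prop} (hr : ∀ a b, r a b → r b a) {S : Set V} {c : V}
    (h : ∀ A ⊆ S, A.Nonempty → c ∉ A → ∃ a ∈ A, ∃ b ∈ S \ A, r a b) : CutConn r S := by
  intro A hA hne hne'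
  by_cases hc : c ∈ A
  · obtain ⟨a, ha, b, hb, hab⟩ := h (S \ A) sdiff_subset hne' (fun h => h.2 hc)
    exact ⟨b, by_contra fun h' => hb.2 ⟨hb.1, h'⟩, a, ha, hr _ _ hab⟩
  · exact h A hA hne hc

theorem CutConn.insert_adj {r : V → V → Prop} (hr : ∀ a b, r a b → r b a) {S : Set V}
    (h : CutConn r S) {x s : V} (hs : s ∈ S) (hxs : r x s) : CutConn r (insert x S) := by
  by_cases hx : x ∈ S
  · rwa [insert_eq_of_mem hx]
  refine CutConn.of_notMem hr (c := x) fun A hA hne hxA => ?_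
  have hAS : A ⊆ S := fun a ha => (hA ha).resolve_left (fun e => hxA (e ▸ ha))
  by_cases hne' : (S \ A).Nonempty
  · obtain ⟨a, ha, b, hb, hab⟩ := h A hAS hne hne'
    exact ⟨a, ha, b, ⟨mem_insert_of_mem _ hb.1, hb.2⟩, hab⟩
  · have hsA : s ∈ A := by_contra fun h' => hne' ⟨s, hs, h'⟩
    exact ⟨s, hsA, x, ⟨mem_insert _ _, hxA⟩, hr _ _ hxs⟩

/-- A side of a connected set at a cut vertex, together with the cut vertex, is connected. -/
theorem CutConn.side {r : V → V → Prop} (hr : ∀ a b, r a b → r b a) {S P : Set V} {v : V}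
    (h : CutConn r S) (hv : v ∈ S) (hP : P ⊆ S)
    (hcut : ∀ a ∈ P, ∀ b ∈ S, b ∉ P → b ≠ v → ¬ r a b) : CutConn r (insert v P) := by
  refine CutConn.of_notMem hr (c := v) fun A hA hne hvA => ?_
  have hAP : A ⊆ P := fun a ha => (hA ha).resolve_left (fun e => hvA (e ▸ ha))
  obtain ⟨a, ha, b, hb, hab⟩ := h A (hAP.trans hP) hne ⟨v, hv, hvA⟩
  refine ⟨a, ha, b, ⟨?_, hb.2⟩, hab⟩
  by_contra hb'
  rw [mem_insert_iff, not_or] at hb'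
  exact hcut a (hAP ha) b hb.1 hb'.2 hb'.1 hab

/-- The underlying adjacency of a digraph relation. -/
def Und (D : V → V → Prop) (u v : V) : Prop := D u v ∨ D v u

theorem Und.symm {D : V → V → Prop} (a b : V) (h : Und D a b) : Und D b a := Or.symm h

theorem und_flip (D : V → V → Prop) : Und (fun a b => D b a) = Und D := by
  funext a b
  exact propext or_comm

/-- `S` is nonempty, connected, and has no separating vertex. -/
def Nonsep (D : V → V → Prop) (S : Set V) : Prop :=
  S.Nonempty ∧ CutConn (Und D) S ∧ ∀ v ∈ S, CutConn (Und D) (S \ {v})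

end Connectivity

/-! ### Covers and greedy coloring -/

section Covers

variable {V α : Type*}

/-- The compatibility relation of a cover: it projects to arcs, and is a matching over each. -/
structure CoverRel (D : V → V → Prop) (A : V → α → V → α → Prop) : Prop where
  sub : ∀ {u x v y}, A u x v y → D u v
  injl : ∀ {u x x' v y}, A u x v y → A u x' v y → x = x'
  injr : ∀ {u x v y y'}, A u x v y → A u x v y' → y = y'

theorem CoverRel.flip {D : V → V → Prop} {A : V → α → V → α → Prop} (h : CoverRel D A) :
    CoverRel (fun a b => D b a) (fun u x v y => A v y u x) :=
  ⟨fun h1 => h.sub h1, fun h1 h2 => h.injr h1 h2, fun h1 h2 => h.injl h1 h2⟩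

/-- The relation induced on the vertices by a choice of colors. -/
def Rel (A : V → α → V → α → Prop) (φ : V → α) (a b : V) : Prop := A a (φ a) b (φ b)

open Classical in
-- Pigeonhole: each vertex of N forbids at most one color of u.
theorem exists_color_of_card_lt [Finite V] {A : V → α → V → α → Prop} {X : Finset α} {u : V}
    {N : Set V} {φ : V → α} (hinj : ∀ {x x' v y}, A u x v y → A u x' v y → x = x')
    (hN : N.ncard < X.card) : ∃ x ∈ X, ∀ w ∈ N, ¬ A u x w (φ w) := by
  by_contra! h
  have : Nonempty V := ⟨u⟩
  choose! g hg hA using h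
  have : X.card ≤ N.ncard := by
    rw [← Set.ncard_coe_finset X]
    refine Set.ncard_le_ncard_of_injOn g (fun x hx => hg x hx) ?_ N.toFinite
    intro x hx x' hx' e
    have h1 := hA x hx
    rw [e] at h1
    exact hinj h1 (hA x' hx')
  omega

open Classical in
theorem rel_update_of_ne {A : V → α → V → α → Prop} {φ : V → α} {u : V} {x : α} {a b : V}
    (ha : a ≠ u) (hb : b ≠ u) : Rel A (Function.update φ u x) a b ↔ Rel A φ a b := by
  simp [Rel, Function.update_of_ne ha, Function.update_of_ne hb]

open Classical in
theorem rel_update_left {A : V → α → V → α → Prop} {φ : V → α} {u : V} {x : α} {b : V}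
    (hb : b ≠ u) : Rel A (Function.update φ u x) u b ↔ A u x b (φ b) := by
  simp [Rel, Function.update_of_ne hb]

open Classical in
theorem acyc_update {A : V → α → V → α → Prop} {φ : V → α} {u : V} {x : α} {S : Set V}
    (hu : u ∉ S) (h : Acyc (Rel A φ) S) : Acyc (Rel A (Function.update φ u x)) S :=
  h.congr fun _ ha _ hb hab =>
    (rel_update_of_ne (ne_of_mem_of_not_mem ha hu) (ne_of_mem_of_not_mem hb hu)).1 hab

/-- The out-degree of `v` into `U`. -/
noncomputable def outdeg (D : V → V → Prop) (U : Set V) (v : V) : ℕ := {w ∈ U | D v w}.ncard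

/-- Lists of size at least both degrees in `U`. -/
def Feasible (D : V → V → Prop) (U : Set V) (X : V → Finset α) : Prop :=
  ∀ v ∈ U, outdeg D U v ≤ (X v).card ∧ outdeg (fun a b => D b a) U v ≤ (X v).card

theorem Feasible.flip {D : V → V → Prop} {U : Set V} {X : V → Finset α} (h : Feasible D U X) :
    Feasible (fun a b => D b a) U X := fun v hv => (h v hv).symm

open Classical in
-- The uncolored out-neighbor a leaves fewer colored out-neighbors than colors, so some color makes
-- u a sink.
theorem exists_extend_out [Finite V] {D : V → V → Prop} {A : V → α → V → α → Prop}
    {X : V → Finset α} {U S : Set V} (hD : ∀ v, ¬ D v v) (hA : CoverRel D A)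
    (hX : Feasible D U X) {φ : V → α} (hS : S ⊆ U) (hac : Acyc (Rel A φ) S) {u a : V}
    (hu : u ∈ U) (huS : u ∉ S) (ha : a ∈ U) (haS : a ∉ S) (hua : D u a) :
    ∃ x ∈ X u, Acyc (Rel A (Function.update φ u x)) (insert u S) := by
  have hlt : {w ∈ S | D u w}.ncard < (X u).card := by
    refine lt_of_lt_of_le ?_ (hX u hu).1
    refine Set.ncard_lt_ncard ?_ (Set.toFinite _)
    refine ⟨fun w hw => ⟨hS hw.1, hw.2⟩, fun h => haS (h ⟨ha, hua⟩).1⟩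
  obtain ⟨x, hx, h1⟩ := exists_color_of_card_lt (A := A) (φ := φ) (fun h h' => hA.injl h h') hlt
  refine ⟨x, hx, (acyc_update huS hac).insert_of_no_out (fun h => hD u (hA.sub h)) ?_⟩
  intro y hy h
  have hyu : y ≠ u := fun e => huS (e ▸ hy)
  have h2 := (rel_update_left hyu).1 h
  exact h1 y ⟨hy, hA.sub h2⟩ h2

open Classical in
theorem exists_extend [Finite V] {D : V → V → Prop} {A : V → α → V → α → Prop}
    {X : V → Finset α} {U S : Set V} (hD : ∀ v, ¬ D v v) (hA : CoverRel D A)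
    (hX : Feasible D U X) {φ : V → α} (hS : S ⊆ U) (hac : Acyc (Rel A φ) S) {u a : V}
    (hu : u ∈ U) (huS : u ∉ S) (ha : a ∈ U) (haS : a ∉ S) (hua : Und D u a) :
    ∃ x ∈ X u, Acyc (Rel A (Function.update φ u x)) (insert u S) := by
  rcases hua with hua | hua
  · exact exists_extend_out hD hA hX hS hac hu huS ha haS hua
  · obtain ⟨x, hx, h⟩ := exists_extend_out (D := fun a b => D b a) hD hA.flip hX.flip (φ := φ) hS
      hac.flip hu huS ha haS hua
    exact ⟨x, hx, h.flip⟩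

open Classical in
/-- Greedy coloring: a coloring of `S` extends to all of `U` but one vertex `v`, if `U \ S` is
connected. -/
theorem exists_extend_all [Finite V] {D : V → V → Prop} {A : V → α → V → α → Prop}
    {X : V → Finset α} {U S : Set V} (hD : ∀ v, ¬ D v v) (hA : CoverRel D A)
    (hX : Feasible D U X) {φ : V → α} (hS : S ⊆ U) (hac : Acyc (Rel A φ) S)
    (hφ : ∀ s ∈ S, φ s ∈ X s) {v : V} (hv : v ∈ U) (hvS : v ∉ S)
    (hconn : CutConn (Und D) (U \ S)) :
    ∃ ψ : V → α, (∀ s ∈ S, ψ s = φ s) ∧ (∀ s ∈ U \ {v}, ψ s ∈ X s) ∧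
      Acyc (Rel A ψ) (U \ {v}) := by
  -- `Ext B` says that the vertices of B other than v can always be colored last. A maximal such B
  -- is U \ S: if an edge leaves B for u, then u can be colored while its neighbor in B is still
  -- uncolored.
  let Ext : Set V → Prop := fun B => ∀ φ : V → α, (∀ s ∈ U \ B, φ s ∈ X s) →
    Acyc (Rel A φ) (U \ B) → ∃ ψ : V → α, (∀ s ∈ U \ B, ψ s = φ s) ∧
      (∀ s ∈ U \ {v}, ψ s ∈ X s) ∧ Acyc (Rel A ψ) (U \ {v})
  have hstart : Ext {v} := fun φ h1 h2 => ⟨φ, fun _ _ => rfl, h1, h2⟩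
  let F : Set (Set V) := {B | v ∈ B ∧ B ⊆ U \ S ∧ Ext B}
  obtain ⟨B, hB⟩ := (Set.toFinite F).exists_maximal
    ⟨{v}, rfl, by simp [singleton_subset_iff, hv, hvS], hstart⟩
  obtain ⟨hvB, hBU, hExt⟩ := hB.prop
  have hBeq : B = U \ S := by
    by_contra hne
    have hne' : ((U \ S) \ B).Nonempty := by
      rw [Set.sdiff_nonempty]
      exact fun h => hne (hBU.antisymm h)
    obtain ⟨a, ha, u, hu, hau⟩ := hconn B hBU ⟨v, hvB⟩ hne'
    have hmem : insert u B ∈ F := by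
      refine ⟨mem_insert_of_mem _ hvB, insert_subset hu.1 hBU, ?_⟩
      intro φ h1 h2
      obtain ⟨x, hx, hx2⟩ := exists_extend hD hA hX (S := U \ insert u B) sdiff_subset h2
        (u := u) (a := a) hu.1.1 (by simp) (hBU ha).1 (by simp [ha]) hau.symm
      have hins : insert u (U \ insert u B) = U \ B := by
        ext z
        simp only [mem_insert_iff, mem_sdiff]
        constructor
        · rintro (rfl | h)
          · exact ⟨hu.1.1, hu.2⟩
          · exact ⟨h.1, fun h' => h.2 (Or.inr h')⟩
        · intro h
          by_cases hz : z = u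
          · exact Or.inl hz
          · exact Or.inr ⟨h.1, fun h' => h'.elim hz h.2⟩
      rw [hins] at hx2
      obtain ⟨ψ, h3, h4, h5⟩ := hExt (Function.update φ u x) (by
        intro s hs
        by_cases hsu : s = u
        · subst hsu; simpa using hx
        · rw [Function.update_of_ne hsu]
          exact h1 s ⟨hs.1, by simp [hsu, hs.2]⟩) hx2
      refine ⟨ψ, fun s hs => ?_, h4, h5⟩
      have hsu : s ≠ u := fun e => hs.2 (e ▸ mem_insert _ _)
      rw [h3 s ⟨hs.1, fun h => hs.2 (mem_insert_of_mem _ h)⟩, Function.update_of_ne hsu]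
    exact hu.2 (hB.le_of_ge hmem (subset_insert _ _) (mem_insert _ _))
  have hUB : U \ B = S := by
    rw [hBeq, sdiff_sdiff_cancel_left hS]
  obtain ⟨ψ, h1, h2, h3⟩ := hExt φ (by rwa [hUB]) (by rwa [hUB])
  exact ⟨ψ, by rwa [hUB] at h1, h2, h3⟩

end Covers

/-! ### Bad covers and cut vertices -/

section Gluing

variable {V : Type*}

theorem outdeg_mono [Finite V] (D : V → V → Prop) {S U : Set V} (h : S ⊆ U) (v : V) :
    outdeg D S v ≤ outdeg D U v :=
  ncard_le_ncard (fun _ hw => ⟨h hw.1, hw.2⟩) (toFinite _)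

theorem Feasible.mono [Finite V] {α : Type*} {D : V → V → Prop} {S U : Set V} {X : V → Finset α}
    (hX : Feasible D U X) (h : S ⊆ U) : Feasible D S X := fun v hv =>
  ⟨(outdeg_mono D h v).trans (hX v (h hv)).1, (outdeg_mono _ h v).trans (hX v (h hv)).2⟩

/-- There is a cover of the subdigraph induced by `S`, with lists of size at least the maximum of
the out-degree and the in-degree, that has no acyclic coloring. -/
def Uncolorable (D : V → V → Prop) (α : Type*) (S : Set V) : Prop :=
  ∃ (X : V → Finset α) (A : V → α → V → α → Prop), CoverRel D A ∧ Feasible D S X ∧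
    ∀ φ : V → α, (∀ v ∈ S, φ v ∈ X v) → ¬ Acyc (Rel A φ) S

/-- `S` and `T` share exactly the vertex `v`, and no edge joins their remainders. -/
structure MeetAt (D : V → V → Prop) (S T : Set V) (v : V) : Prop where
  left : v ∈ S
  right : v ∈ T
  eq_of_mem : ∀ a ∈ S, a ∈ T → a = v
  not_und : ∀ a ∈ S, ∀ b ∈ T, a ≠ v → b ≠ v → ¬ Und D a b

theorem MeetAt.symm {D : V → V → Prop} {S T : Set V} {v : V} (h : MeetAt D S T v) :
    MeetAt D T S v :=
  ⟨h.right, h.left, fun a ha hb => h.eq_of_mem a hb ha,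
    fun a ha b hb hav hbv hab => h.not_und b hb a ha hbv hav hab.symm⟩

theorem MeetAt.flip {D : V → V → Prop} {S T : Set V} {v : V} (h : MeetAt D S T v) :
    MeetAt (fun a b => D b a) S T v :=
  ⟨h.left, h.right, h.eq_of_mem, by rw [und_flip]; exact h.not_und⟩

theorem MeetAt.outdeg_add [Finite V] {D : V → V → Prop} {S T : Set V} {v : V}
    (hD : ∀ v, ¬ D v v) (h : MeetAt D S T v) :
    outdeg D S v + outdeg D T v = outdeg D (S ∪ T) v := by
  unfold outdeg
  rw [← ncard_union_eq]
  · congr 1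
    ext w
    simp only [mem_union, mem_ofPred_eq]
    tauto
  · rw [Set.disjoint_left]
    intro w hw hw'
    have := h.eq_of_mem w hw.1 hw'.1
    subst this
    exact hD w hw.2

theorem MeetAt.outdeg_le [Finite V] {D : V → V → Prop} {S T : Set V} {v u : V}
    (h : MeetAt D S T v) (hu : u ∈ S) (huv : u ≠ v) : outdeg D (S ∪ T) u ≤ outdeg D S u := by
  refine ncard_le_ncard (fun w hw => ⟨?_, hw.2⟩) (toFinite _)
  rcases hw.1 with h1 | h1
  · exact h1
  · by_cases hwv : w = v
    · exact hwv ▸ h.left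
    · exact absurd (Or.inl hw.2) (h.not_und u hu w h1 huv hwv)

open Classical in
-- A color of v without arcs to the chosen colors makes v a sink and is not bad. Each out-neighbor
-- accounts for at most one bad color.
theorem card_bad_le [Finite V] {α : Type*} {D : V → V → Prop} {A : V → α → V → α → Prop}
    (hD : ∀ v, ¬ D v v) (hA : CoverRel D A) {X : Finset α} {U : Set V} {v : V} (hv : v ∈ U)
    {φ : V → α} (hφ : Acyc (Rel A φ) (U \ {v})) :
    (X.filter fun x => ¬ Acyc (Rel A (Function.update φ v x)) U).card ≤ outdeg D U v := by
  by_contra! hlt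
  obtain ⟨x, hx, h1⟩ := exists_color_of_card_lt (A := A) (φ := φ) (fun h h' => hA.injl h h') hlt
  refine (Finset.mem_filter.1 hx).2 ?_
  have h2 := (acyc_update (A := A) (x := x) (u := v) (by simp) hφ).insert_of_no_out (x := v)
    (fun h => hD v (hA.sub h)) ?_
  · rwa [insert_sdiff_singleton, insert_eq_of_mem hv] at h2
  · intro y hy h
    have h3 := (rel_update_left hy.2).1 h
    exact h1 y ⟨hy.1, hA.sub h3⟩ h3

open Classical in
-- Fix a coloring of T off v and shrink the list of v to the colors that complete it acyclically. At
-- most the degree of v in T is lost, and the degrees of v in S and T add up, so the list still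
-- suffices on S. A coloring of S from these lists would glue to one of the union.
theorem Uncolorable.left [Finite V] {α : Type*} {D : V → V → Prop} {S T : Set V} {v : V}
    (hD : ∀ v, ¬ D v v) (hm : MeetAt D S T v) (hT : CutConn (Und D) T)
    (h : Uncolorable D α (S ∪ T)) : Uncolorable D α S := by
  obtain ⟨X, A, hA, hX, hun⟩ := h
  rcases isEmpty_or_nonempty α with hα | hα
  · exact ⟨X, A, hA, hX.mono subset_union_left, fun φ => isEmptyElim (φ v)⟩
  obtain ⟨φ, -, hφ, hac⟩ := exists_extend_all hD hA (hX.mono (subset_union_right (s := S)))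
    (φ := fun _ => Classical.arbitrary α) (empty_subset T) (acyc_empty _) (by simp)
    hm.right (notMem_empty v) (by simpa using hT)
  let good : Finset α := (X v).filter fun x => Acyc (Rel A (Function.update φ v x)) T
  have hgood : ∀ D' : V → V → Prop, (∀ v, ¬ D' v v) → MeetAt D' S T v →
      outdeg D' (S ∪ T) v ≤ (X v).card →
      ((X v).filter fun x => ¬ Acyc (Rel A (Function.update φ v x)) T).card ≤ outdeg D' T v →
      outdeg D' S v ≤ good.card := by
    intro D' hD' hm' h1 h2
    have h3 := hm'.outdeg_add hD'
    have h4 : good.card + _ = (X v).card := Finset.card_filter_add_card_filter_not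
      (s := X v) (fun x => Acyc (Rel A (Function.update φ v x)) T)
    omega
  have hvU : v ∈ S ∪ T := Or.inl hm.left
  refine ⟨Function.update X v good, A, hA, ?_, ?_⟩
  · intro u hu
    by_cases huv : u = v
    · subst huv
      rw [Function.update_self]
      refine ⟨hgood D hD hm (hX u hvU).1 (card_bad_le hD hA hm.right hac),
        hgood _ hD hm.flip (hX u hvU).2 ?_⟩
      refine le_trans (Finset.card_le_card ?_)
        (card_bad_le (D := fun a b => D b a) (X := X u) hD hA.flip hm.right hac.flip)
      intro x hx
      rw [Finset.mem_filter] at hx ⊢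
      exact ⟨hx.1, fun h => hx.2 h.flip⟩
    · rw [Function.update_of_ne huv]
      exact hX.mono subset_union_left u hu
  · intro ψ hψ hacS
    have hψv : ψ v ∈ good := by simpa using hψ v hm.left
    have hne : ∀ a ∈ T, a ≠ v → a ∉ S := fun a ha hav haS => hav (hm.eq_of_mem a haS ha)
    let χ : V → α := fun a => if a ∈ S then ψ a else φ a
    have hχS : ∀ a ∈ S, χ a = ψ a := fun a ha => if_pos ha
    have hχT : ∀ a ∈ T, χ a = Function.update φ v (ψ v) a := by
      intro a ha
      by_cases hav : a = v
      · subst hav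
        rw [hχS a hm.left, Function.update_self]
      · rw [Function.update_of_ne hav]
        exact if_neg (hne a ha hav)
    refine hun χ ?_ (Acyc.union (v := v) ?_ ?_ hm.left hm.right ?_ ?_)
    · intro a ha
      by_cases haS : a ∈ S
      · rw [hχS a haS]
        by_cases hav : a = v
        · subst hav
          exact (Finset.mem_filter.1 hψv).1
        · simpa [hav] using hψ a haS
      · have haT := ha.resolve_left haS
        have hav : a ≠ v := fun e => haS (e ▸ hm.left)
        rw [hχT a haT, Function.update_of_ne hav]
        exact hφ a ⟨haT, hav⟩
    · refine hacS.congr fun a ha b hb hab => ?_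
      rwa [Rel, hχS a ha, hχS b hb] at hab
    · refine (Finset.mem_filter.1 hψv).2.congr fun a ha b hb hab => ?_
      rwa [Rel, hχT a ha, hχT b hb] at hab
    · exact fun a ha b hb hav hbv hab => hm.not_und a ha b hb hav hbv (Or.inl (hA.sub hab))
    · exact fun a ha b hb hav hbv hab => hm.not_und b hb a ha hbv hav (Or.inr (hA.sub hab))

/-- The disjoint union of two compatibility relations. -/
def sumRel {α β : Type*} (A : V → α → V → α → Prop) (B : V → β → V → β → Prop) :
    V → α ⊕ β → V → α ⊕ β → Prop
  | u, .inl x, v, .inl y => A u x v y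
  | u, .inr x, v, .inr y => B u x v y
  | _, _, _, _ => False

theorem CoverRel.sum {α β : Type*} {D : V → V → Prop} {A : V → α → V → α → Prop}
    {B : V → β → V → β → Prop} (hA : CoverRel D A) (hB : CoverRel D B) :
    CoverRel D (sumRel A B) where
  sub {u x v y} h := by
    rcases x with x | x <;> rcases y with y | y
    exacts [hA.sub h, h.elim, h.elim, hB.sub h]
  injl {u x x' v y} h h' := by
    rcases x with x | x <;> rcases x' with x' | x' <;> rcases y with y | y
    all_goals first | exact False.elim h | exact False.elim h' | skip
    exacts [congrArg _ (hA.injl h h'), congrArg _ (hB.injl h h')]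
  injr {u x v y y'} h h' := by
    rcases x with x | x <;> rcases y with y | y <;> rcases y' with y' | y'
    all_goals first | exact False.elim h | exact False.elim h' | skip
    exacts [congrArg _ (hA.injr h h'), congrArg _ (hB.injr h h')]

open Classical in
-- The two palettes never interact, and only v has colors from both. The palette chosen at v then
-- colors its whole piece, contradicting the bad cover of that piece.
theorem Uncolorable.union [Finite V] {α β : Type*} {D : V → V → Prop} {S T : Set V} {v : V}
    (hD : ∀ v, ¬ D v v) (hm : MeetAt D S T v) (hS : Uncolorable D α S) (hT : Uncolorable D β T) :
    Uncolorable D (α ⊕ β) (S ∪ T) := by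
  obtain ⟨X, A, hA, hX, hun⟩ := hS
  obtain ⟨Y, B, hB, hY, hun'⟩ := hT
  let Z : V → Finset (α ⊕ β) := fun a =>
    (if a ∈ S then X a else ∅).disjSum (if a ∈ T then Y a else ∅)
  have hcard : ∀ a, (Z a).card =
      (if a ∈ S then X a else ∅).card + (if a ∈ T then Y a else ∅).card :=
    fun a => Finset.card_disjSum _ _
  refine ⟨Z, sumRel A B, hA.sum hB, ?_, ?_⟩
  · intro u hu
    rw [hcard]
    by_cases huv : u = v
    · subst huv
      rw [if_pos hm.left, if_pos hm.right, ← hm.outdeg_add hD,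
        ← hm.flip.outdeg_add (D := fun a b => D b a) hD]
      exact ⟨add_le_add (hX u hm.left).1 (hY u hm.right).1,
        add_le_add (hX u hm.left).2 (hY u hm.right).2⟩
    · rcases hu with hu | hu
      · rw [if_pos hu]
        have h1 := hm.outdeg_le hu huv
        have h2 := hm.flip.outdeg_le hu huv
        have h3 := hX u hu
        omega
      · rw [if_pos hu, union_comm]
        have h1 := hm.symm.outdeg_le hu huv
        have h2 := hm.symm.flip.outdeg_le hu huv
        have h3 := hY u hu
        omega
  · intro φ hφ hac
    rcases hv : φ v with x | y
    · have hex : ∀ u, ∃ x : α, u ∈ S → φ u = Sum.inl x ∧ x ∈ X u := by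
        intro u
        by_cases hu : u ∈ S
        · have h1 := hφ u (Or.inl hu)
          rcases hφu : φ u with x' | y'
          · refine ⟨x', fun _ => ⟨rfl, ?_⟩⟩
            rw [hφu, Finset.inl_mem_disjSum, if_pos hu] at h1
            exact h1
          · rw [hφu, Finset.inr_mem_disjSum] at h1
            by_cases huT : u ∈ T
            · have := hm.eq_of_mem u hu huT
              subst this
              rw [hv] at hφu
              cases hφu
            · simp [huT] at h1
        · exact ⟨x, fun h => absurd h hu⟩
      choose ψ hψ using hex
      refine hun ψ (fun u hu => (hψ u hu).2) ((hac.mono subset_union_left).congr ?_)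
      intro a ha b hb hab
      rw [Rel, (hψ a ha).1, (hψ b hb).1]
      exact hab
    · have hex : ∀ u, ∃ y : β, u ∈ T → φ u = Sum.inr y ∧ y ∈ Y u := by
        intro u
        by_cases hu : u ∈ T
        · have h1 := hφ u (Or.inr hu)
          rcases hφu : φ u with x' | y'
          · rw [hφu, Finset.inl_mem_disjSum] at h1
            by_cases huS : u ∈ S
            · have := hm.eq_of_mem u huS hu
              subst this
              rw [hv] at hφu
              cases hφu
            · simp [huS] at h1
          · refine ⟨y', fun _ => ⟨rfl, ?_⟩⟩
            rw [hφu, Finset.inr_mem_disjSum, if_pos hu] at h1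
            exact h1
        · exact ⟨y, fun h => absurd h hu⟩
      choose ψ hψ using hex
      refine hun' ψ (fun u hu => (hψ u hu).2) ((hac.mono subset_union_right).congr ?_)
      intro a ha b hb hab
      rw [Rel, (hψ a ha).1, (hψ b hb).1]
      exact hab

end Gluing

/-! ### Bad covers of the three kinds of bricks -/

section BaseCovers

variable {V : Type*}

theorem outdeg_le_of_subset [Finite V] {D : V → V → Prop} {S : Set V} {v : V} {F : Finset V}
    (h : ∀ w ∈ S, D v w → w ∈ F) : outdeg D S v ≤ F.card := by
  rw [← ncard_coe_finset F]
  exact ncard_le_ncard (fun w hw => h w hw.1 hw.2) (toFinite _)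

theorem uncolorable_of_directedCycle [Finite V] {D : V → V → Prop} {S : Set V} {p : ℕ}
    (c : ZMod p ≃ S) (hc : ∀ i j, D (c i) (c j) ↔ j = i + 1) : Uncolorable D Unit S := by
  classical
  refine ⟨fun _ => Finset.univ, fun a _ b _ => D a b, ⟨id, fun _ _ => rfl, fun _ _ => rfl⟩, ?_, ?_⟩
  · intro v hv
    obtain ⟨i, hi⟩ := c.surjective ⟨v, hv⟩
    obtain rfl : (c i : V) = v := by rw [hi]
    constructor
    · refine outdeg_le_of_subset (F := {(c (i + 1) : V)}) fun w hw h => ?_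
      obtain ⟨j, hj⟩ := c.surjective ⟨w, hw⟩
      obtain rfl : (c j : V) = w := by rw [hj]
      rw [(hc i j).1 h]; simp
    · refine outdeg_le_of_subset (F := {(c (i - 1) : V)}) fun w hw h => ?_
      obtain ⟨j, hj⟩ := c.surjective ⟨w, hw⟩
      obtain rfl : (c j : V) = w := by rw [hj]
      rw [(hc j i).1 h]; simp
  · intro φ _ hac
    obtain ⟨a, ha, h⟩ := hac S subset_rfl ⟨c 0, (c 0).2⟩
    obtain ⟨i, hi⟩ := c.surjective ⟨a, ha⟩
    obtain rfl : (c i : V) = a := by rw [hi]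
    exact h (c (i + 1)) (c (i + 1)).2 ((hc _ _).2 rfl)

/-- All matchings are the identity on one color fewer than there are vertices: two vertices share a
color and form a digon. -/
theorem uncolorable_of_complete [Finite V] {D : V → V → Prop} {S : Set V} (hne : S.Nonempty)
    (hS : ∀ a ∈ S, ∀ b ∈ S, D a b ↔ a ≠ b) : Uncolorable D (Fin (S.ncard - 1)) S := by
  classical
  refine ⟨fun _ => Finset.univ, fun a x b y => D a b ∧ x = y,
    ⟨fun h => h.1, fun h h' => h.2.trans h'.2.symm, fun h h' => h.2.symm.trans h'.2⟩, ?_, ?_⟩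
  · intro v hv
    rw [Finset.card_fin]
    rw [← ncard_sdiff_singleton_of_mem hv]
    constructor
    · exact ncard_le_ncard (fun w hw => ⟨hw.1, ((hS v hv w hw.1).1 hw.2).symm⟩) (toFinite _)
    · exact ncard_le_ncard (fun w hw => ⟨hw.1, ((hS w hw.1 v hv).1 hw.2)⟩) (toFinite _)
  · intro φ _ hac
    have hpos : 0 < S.ncard := (ncard_pos (toFinite S)).2 hne
    obtain ⟨a, ha, b, hb, hab, e⟩ := exists_ne_map_eq_of_ncard_lt_of_maps_to
      (s := S) (t := (univ : Set (Fin (S.ncard - 1)))) (f := φ)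
      (by rw [ncard_univ, Nat.card_fin]; omega) (fun _ _ => mem_univ _) (toFinite _)
    obtain ⟨z, hz, h⟩ := hac {a, b} (by rintro _ (rfl | rfl) <;> assumption) ⟨a, Or.inl rfl⟩
    rcases hz with rfl | rfl
    · exact h b (Or.inr rfl) ⟨(hS _ ha _ hb).2 hab, e⟩
    · exact h a (Or.inl rfl) ⟨(hS _ hb _ ha).2 hab.symm, e.symm⟩

/-- Two colors, with crossed matchings on every edge but the closing one, where the matching is
straight. Avoiding digons forces a constant coloring along the path, which is a digon on the closing
edge. This works for both parities. -/
theorem uncolorable_of_bidirectedCycle [Finite V] {D : V → V → Prop} {S : Set V} {n : ℕ}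
    (c : Fin (n + 3) ≃ S)
    (hc : ∀ i j, D (c i) (c j) ↔ (SimpleGraph.cycleGraph (n + 3)).Adj i j) :
    Uncolorable D Bool S := by
  classical
  let s : V := c 0
  let l : V := c (Fin.last (n + 2))
  let A : V → Bool → V → Bool → Prop := fun a x b y =>
    D a b ∧ if (a = s ∧ b = l) ∨ (a = l ∧ b = s) then x = y else x ≠ y
  have hadj : ∀ i j, D (c i) (c j) ↔ i - j = 1 ∨ j - i = 1 := fun i j =>
    (hc i j).trans SimpleGraph.cycleGraph_adj
  have hsymm : ∀ i j, D (c i) (c j) → D (c j) (c i) := fun i j h =>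
    (hc j i).2 ((hc i j).1 h).symm
  refine ⟨fun _ => Finset.univ, A, ⟨fun h => h.1, ?_, ?_⟩, ?_, ?_⟩
  · intro u x x' v y h h'
    have h1 := h.2
    have h2 := h'.2
    split_ifs at h1 h2
    · exact h1.trans h2.symm
    · revert h1 h2; cases x <;> cases x' <;> cases y <;> simp
  · intro u x v y y' h h'
    have h1 := h.2
    have h2 := h'.2
    split_ifs at h1 h2
    · exact h1.symm.trans h2
    · revert h1 h2; cases x <;> cases y' <;> cases y <;> simp
  · intro v hv
    obtain ⟨i, hi⟩ := c.surjective ⟨v, hv⟩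
    obtain rfl : (c i : V) = v := by rw [hi]
    have h2 : ({(c (i + 1) : V), (c (i - 1) : V)} : Finset V).card ≤ 2 := Finset.card_le_two
    have hmem : ∀ w ∈ S, D (c i) w → w ∈ ({(c (i + 1) : V), (c (i - 1) : V)} : Finset V) := by
      intro w hw h
      obtain ⟨j, hj⟩ := c.surjective ⟨w, hw⟩
      obtain rfl : (c j : V) = w := by rw [hj]
      rcases (hadj i j).1 h with h | h
      · have : j = i - 1 := by rw [← h]; abel
        simp [this]
      · have : j = i + 1 := by rw [← h]; abel
        simp [this]
    refine ⟨(outdeg_le_of_subset hmem).trans h2,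
      (outdeg_le_of_subset fun w hw h => hmem w hw ?_).trans h2⟩
    obtain ⟨j, hj⟩ := c.surjective ⟨w, hw⟩
    obtain rfl : (c j : V) = w := by rw [hj]
    exact hsymm _ _ h
  · intro φ _ hac
    have hno : ∀ i j, Rel A φ (c i) (c j) → False := by
      intro i j h
      have h' : Rel A φ (c j) (c i) := by
        refine ⟨hsymm _ _ h.1, ?_⟩
        have h2 := h.2
        split_ifs at h2 ⊢ with h3 h4 h4
        · exact h2.symm
        · exact absurd (h3.symm.imp And.symm And.symm) h4
        · exact absurd (h4.symm.imp And.symm And.symm) h3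
        · exact h2.symm
      obtain ⟨z, hz, h1⟩ := hac {(c i : V), (c j : V)}
        (by rintro _ (rfl | rfl); exacts [(c i).2, (c j).2]) ⟨c i, Or.inl rfl⟩
      rcases hz with rfl | rfl
      · exact h1 _ (Or.inr rfl) h
      · exact h1 _ (Or.inl rfl) h'
    have hinj : ∀ i j, (c i : V) = c j → i = j := fun i j h => c.injective (Subtype.ext h)
    have hconst : ∀ i : Fin (n + 3), φ (c i) = φ (c 0) := by
      intro i
      induction i using Fin.induction with
      | zero => rfl
      | succ i ih =>
        rw [← ih]
        by_contra hne
        refine hno i.castSucc i.succ ⟨(hadj _ _).2 (Or.inr ?_), ?_⟩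
        · exact sub_eq_of_eq_add' (Fin.coeSucc_eq_succ).symm
        · rw [if_neg]
          · exact fun e => hne e.symm
          · rintro (⟨h1, h2⟩ | ⟨h1, h2⟩)
            · have h3 : (i : ℕ) = 0 := congrArg Fin.val (hinj _ _ h1)
              have h4 : (i : ℕ) + 1 = n + 2 := congrArg Fin.val (hinj _ _ h2)
              omega
            · have h2 := congrArg Fin.val (hinj _ _ h2)
              simp at h2
    refine hno 0 (Fin.last _) ⟨(hadj _ _).2 (Or.inl ?_), ?_⟩
    · exact sub_eq_of_eq_add' (Fin.last_add_one _).symm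
    · rw [if_pos (Or.inl ⟨rfl, rfl⟩)]
      exact (hconst _).symm

end BaseCovers

/-! ### Nonseparable obstructions and the moving uncolored vertex -/

section Obstruction

variable {V α : Type*}

theorem acyc_singleton {R : V → V → Prop} {v : V} (h : ¬ R v v) : Acyc R {v} := by
  intro S hS hne
  obtain ⟨s, hs⟩ := hne
  refine ⟨s, hs, fun b hb => ?_⟩
  rw [hS hs, hS hb]
  exact h

/-- An uncolorable cover, with lists as large as the degrees, of a digraph that has no separating
vertex. -/
structure Obstruction (D : V → V → Prop) (X : V → Finset α) (A : V → α → V → α → Prop) :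
    Prop where
  irrefl : ∀ v, ¬ D v v
  cover : CoverRel D A
  feasible : Feasible D univ X
  not_acyc : ∀ φ : V → α, (∀ v, φ v ∈ X v) → ¬ Acyc (Rel A φ) univ
  conn : CutConn (Und D) univ
  conn_compl : ∀ v, CutConn (Und D) {v}ᶜ
  nonempty : ∀ v, (X v).Nonempty

/-- The coloring `φ` is acyclic off the vertex `v`. -/
def Crit (A : V → α → V → α → Prop) (φ : V → α) (v : V) : Prop := Acyc (Rel A φ) {v}ᶜ

variable {D : V → V → Prop} {X : V → Finset α} {A : V → α → V → α → Prop}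

theorem Crit.flip [Finite V] {φ : V → α} {v : V} (h : Crit A φ v) :
    Crit (fun u x v y => A v y u x) φ v := Acyc.flip h

theorem crit_flip_iff [Finite V] {φ : V → α} {v : V} :
    Crit (fun u x v y => A v y u x) φ v ↔ Crit A φ v := ⟨Crit.flip, Crit.flip⟩

open Classical in
theorem Crit.update {φ : V → α} {v : V} (h : Crit A φ v) (x : α) :
    Crit A (Function.update φ v x) v := acyc_update (by simp) h

open Classical in
theorem update_mem {φ : V → α} (h : ∀ s, φ s ∈ X s) {v : V} {x : α} (hx : x ∈ X v) :
    ∀ s, Function.update φ v x s ∈ X s := by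
  intro s
  by_cases hs : s = v
  · subst hs; simpa using hx
  · rw [Function.update_of_ne hs]; exact h s

namespace Obstruction

theorem ne (O : Obstruction D X A) {u v : V} {x y : α} (h : A u x v y) : u ≠ v := by
  rintro rfl
  exact O.irrefl u (O.cover.sub h)

open Classical in
-- Otherwise x would make v a sink and complete an acyclic coloring.
theorem exists_out (O : Obstruction D X A) {φ : V → α} (hφ : ∀ s, φ s ∈ X s) {v : V}
    (hv : Crit A φ v) {x : α} (hx : x ∈ X v) : ∃ w, A v x w (φ w) := by
  by_contra! hcon
  refine O.not_acyc _ (update_mem hφ hx) ?_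
  have h := (hv.update x).insert_of_no_out (x := v) (fun h => O.ne h rfl) fun y hy h =>
    hcon y ((rel_update_left hy).1 h)
  rwa [show insert v ({v}ᶜ : Set V) = univ by ext z; simp [_root_.em]] at h

variable [Finite V]

theorem flip (O : Obstruction D X A) :
    Obstruction (fun a b => D b a) X (fun u x v y => A v y u x) where
  irrefl := O.irrefl
  cover := O.cover.flip
  feasible := O.feasible.flip
  not_acyc φ hφ h := O.not_acyc φ hφ h.flip
  conn := by rw [und_flip]; exact O.conn
  conn_compl := by rw [und_flip]; exact O.conn_compl
  nonempty := O.nonempty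

open Classical in
theorem exists_crit (O : Obstruction D X A) {S : Set V} {φ : V → α} (hφ : ∀ s ∈ S, φ s ∈ X s)
    (hac : Acyc (Rel A φ) S) (hS : CutConn (Und D) Sᶜ) {v : V} (hv : v ∉ S) :
    ∃ ψ : V → α, (∀ s ∈ S, ψ s = φ s) ∧ (∀ s, ψ s ∈ X s) ∧ Crit A ψ v := by
  obtain ⟨ψ, h1, h2, h3⟩ := exists_extend_all O.irrefl O.cover O.feasible (subset_univ S) hac hφ
    (mem_univ v) hv (by rwa [← compl_eq_univ_sdiff])
  rw [← compl_eq_univ_sdiff] at h2 h3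
  obtain ⟨x, hx⟩ := O.nonempty v
  refine ⟨Function.update ψ v x, fun s hs => ?_, fun s => ?_, Crit.update h3 x⟩
  · rw [Function.update_of_ne (ne_of_mem_of_not_mem hs hv), h1 s hs]
  · by_cases hs : s = v
    · subst hs; simpa using hx
    · rw [Function.update_of_ne hs]; exact h2 s hs

theorem exists_crit_vertex (O : Obstruction D X A) (v : V) :
    ∃ ψ : V → α, (∀ s, ψ s ∈ X s) ∧ Crit A ψ v := by
  obtain ⟨x, -⟩ := O.nonempty v
  obtain ⟨ψ, -, h⟩ := O.exists_crit (φ := fun _ => x) (S := ∅) (by simp) (acyc_empty _)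
    (by simpa using O.conn) (notMem_empty v)
  exact ⟨ψ, h⟩

/-- Distinct colors of v lead to distinct out-neighbors, and there are at least as many colors as
out-neighbors; so both counts agree and the map is a bijection. -/
theorem exists_out_map (O : Obstruction D X A) {φ : V → α} (hφ : ∀ s, φ s ∈ X s) {v : V}
    (hv : Crit A φ v) : ∃ g : α → V, (∀ x ∈ X v, A v x (g x) (φ (g x))) ∧
      g '' (X v) = {w | D v w} ∧ {w | D v w}.ncard = (X v).card := by
  have : Nonempty V := ⟨v⟩
  have hex : ∀ x ∈ X v, ∃ w, A v x w (φ w) := fun _ hx => O.exists_out hφ hv hx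
  choose! g hg using hex
  have hinj : InjOn g (X v : Set α) := by
    intro x hx x' hx' e
    have h1 := hg x hx
    rw [e] at h1
    exact O.cover.injl h1 (hg x' hx')
  have hsub : g '' (X v) ⊆ {w | D v w} := by
    rintro _ ⟨x, hx, rfl⟩
    exact O.cover.sub (hg x hx)
  have hle : {w | D v w}.ncard ≤ (X v).card := by
    have := (O.feasible v (mem_univ v)).1
    simpa [outdeg] using this
  have hcard : (g '' (X v : Set α)).ncard = (X v).card := by
    rw [hinj.ncard_image, ncard_coe_finset]
  refine ⟨g, hg, eq_of_subset_of_ncard_le hsub (hle.trans hcard.ge) (toFinite _), ?_⟩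
  exact le_antisymm hle (hcard ▸ ncard_le_ncard hsub (toFinite _))

theorem ncard_out (O : Obstruction D X A) (v : V) : {w | D v w}.ncard = (X v).card := by
  obtain ⟨ψ, h, h'⟩ := O.exists_crit_vertex v
  obtain ⟨g, -, -, hg⟩ := O.exists_out_map h h'
  exact hg

theorem out_unique (O : Obstruction D X A) {φ : V → α} (hφ : ∀ s, φ s ∈ X s) {v : V}
    (hv : Crit A φ v) {x : α} {w w' : V} (h : A v x w (φ w))
    (h' : A v x w' (φ w')) : w = w' := by
  obtain ⟨g, hg, himg, -⟩ := O.exists_out_map hφ hv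
  have key : ∀ w, A v x w (φ w) → w = g x := by
    intro w hw
    obtain ⟨x', hx', rfl⟩ : w ∈ g '' (X v) := himg ▸ O.cover.sub hw
    rw [O.cover.injl hw (hg x' hx')]
  rw [key w h, key w' h']

theorem exists_color_to (O : Obstruction D X A) {φ : V → α} (hφ : ∀ s, φ s ∈ X s) {v : V}
    (hv : Crit A φ v) {w : V} (hw : D v w) : ∃ x ∈ X v, A v x w (φ w) := by
  obtain ⟨g, hg, himg, -⟩ := O.exists_out_map hφ hv
  obtain ⟨x, hx, rfl⟩ : w ∈ g '' (X v) := himg ▸ hw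
  exact ⟨x, hx, hg x hx⟩

theorem rel_unique (O : Obstruction D X A) {φ : V → α} (hφ : ∀ s, φ s ∈ X s) {v : V}
    (hv : Crit A φ v) {w w' : V} (h : Rel A φ v w) (h' : Rel A φ v w') : w = w' :=
  O.out_unique hφ hv h h'

theorem rel_unique_in (O : Obstruction D X A) {φ : V → α} (hφ : ∀ s, φ s ∈ X s) {v : V}
    (hv : Crit A φ v) {w w' : V} (h : Rel A φ w v) (h' : Rel A φ w' v) : w = w' :=
  O.flip.rel_unique hφ hv.flip h h'

/-- The uncolored vertex moves along an arc of the colors. -/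
theorem crit_of_rel (O : Obstruction D X A) {φ : V → α} (hφ : ∀ s, φ s ∈ X s) {v : V}
    (hv : Crit A φ v) {w : V} (h : Rel A φ v w) : Crit A φ w := by
  have hvw : v ≠ w := O.ne h
  have h1 : Acyc (Rel A φ) ({v}ᶜ ∩ {w}ᶜ) := Acyc.mono hv inter_subset_left
  have h2 := h1.insert_of_no_out (x := v) (fun h => O.ne h rfl) fun y hy h' =>
    hy.2 (O.rel_unique hφ hv h' h)
  refine Acyc.mono h2 fun z hz => ?_
  by_cases hzv : z = v
  · exact Or.inl hzv
  · exact Or.inr ⟨hzv, hz⟩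

theorem crit_of_rel_in (O : Obstruction D X A) {φ : V → α} (hφ : ∀ s, φ s ∈ X s) {v : V}
    (hv : Crit A φ v) {w : V} (h : Rel A φ w v) : Crit A φ w :=
  crit_flip_iff.1 (O.flip.crit_of_rel hφ hv.flip h)

open Classical in
-- Precolor w with y and extend greedily to all vertices but u, which is possible because deleting w
-- keeps the digraph connected. It follows that list sizes agree along arcs.
theorem exists_color_in (O : Obstruction D X A) {u w : V} (h : D u w) {y : α} (hy : y ∈ X w) :
    ∃ x ∈ X u, A u x w y := by
  have huw : u ≠ w := by rintro rfl; exact O.irrefl u h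
  obtain ⟨ψ, h1, h2, h3⟩ := O.exists_crit (S := {w}) (φ := fun _ => y) (by simpa using hy)
    (acyc_singleton fun h => O.ne h rfl) (O.conn_compl w) (v := u) huw
  obtain ⟨x, hx, hA⟩ := O.exists_color_to h2 h3 h
  rw [h1 w rfl] at hA
  exact ⟨x, hx, hA⟩

theorem card_le (O : Obstruction D X A) {u w : V} (h : D u w) : (X w).card ≤ (X u).card := by
  have hex : ∀ y ∈ X w, ∃ x ∈ X u, A u x w y := fun y hy => O.exists_color_in h hy
  choose! g hg hA using hex
  refine Finset.card_le_card_of_injOn g hg ?_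
  intro y hy y' hy' e
  have h1 := hA y hy
  rw [e] at h1
  exact O.cover.injr h1 (hA y' hy')

theorem card_eq (O : Obstruction D X A) (u w : V) : (X u).card = (X w).card := by
  by_contra hne
  obtain ⟨a, ha, b, hb, hab⟩ := O.conn {v | (X v).card = (X w).card} (subset_univ _) ⟨w, rfl⟩
    ⟨u, mem_univ _, hne⟩
  refine hb.2 ?_
  rw [← show (X a).card = (X w).card from ha]
  rcases hab with h | h
  · exact le_antisymm (O.card_le h) (O.flip.card_le h)
  · exact le_antisymm (O.flip.card_le h) (O.card_le h)

/-- The coloring `ψ` is acyclic off `w`, agrees with `φ` on `P`, and no arc joins the colors of `P`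
to those of the vertices outside `P` other than `w`. -/
structure Hole (X : V → Finset α) (A : V → α → V → α → Prop) (P : Set V) (φ ψ : V → α) (w : V) :
    Prop where
  mem : ∀ s, ψ s ∈ X s
  crit : Crit A ψ w
  notMem : w ∉ P
  eq : ∀ p ∈ P, ψ p = φ p
  not_out : ∀ p ∈ P, ∀ q ∉ P, q ≠ w → ¬ Rel A ψ p q
  not_in : ∀ p ∈ P, ∀ q ∉ P, q ≠ w → ¬ Rel A ψ q p

theorem Hole.flip {P : Set V} {φ ψ : V → α} {w : V} (h : Hole X A P φ ψ w) :
    Hole X (fun u x v y => A v y u x) P φ ψ w :=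
  ⟨h.mem, h.crit.flip, h.notMem, h.eq, h.not_in, h.not_out⟩

/-- The vertices other than `b` of the cycle of the coloring `φ`. -/
structure CycleOff (X : V → Finset α) (A : V → α → V → α → Prop) (P : Set V) (φ : V → α)
    (b s z : V) : Prop where
  mem : ∀ s, φ s ∈ X s
  crit : Crit A φ b
  mem_iff : ∀ p, p ∈ P ↔ Crit A φ p ∧ p ≠ b
  rel_succ : Rel A φ b s
  rel_pred : Rel A φ z b

theorem CycleOff.flip {P : Set V} {φ : V → α} {b s z : V} (h : CycleOff X A P φ b s z) :
    CycleOff X (fun u x v y => A v y u x) P φ b z s :=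
  ⟨h.mem, h.crit.flip, fun p => by rw [crit_flip_iff]; exact h.mem_iff p, h.rel_pred, h.rel_succ⟩

variable {P : Set V} {φ ψ : V → α} {b s z w : V}

theorem succ_mem (O : Obstruction D X A) (C : CycleOff X A P φ b s z) : s ∈ P :=
  (C.mem_iff s).2 ⟨O.crit_of_rel C.mem C.crit C.rel_succ, (O.ne C.rel_succ).symm⟩

theorem hole_self (O : Obstruction D X A) (C : CycleOff X A P φ b s z) : Hole X A P φ φ b where
  mem := C.mem
  crit := C.crit
  notMem h := ((C.mem_iff b).1 h).2 rfl
  eq _ _ := rfl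
  not_out p hp q hq hqb h :=
    hq ((C.mem_iff q).2 ⟨O.crit_of_rel C.mem ((C.mem_iff p).1 hp).1 h, hqb⟩)
  not_in p hp q hq hqb h :=
    hq ((C.mem_iff q).2 ⟨O.crit_of_rel_in C.mem ((C.mem_iff p).1 hp).1 h, hqb⟩)

open Classical in
/-- If a color of the uncolored vertex is adjacent to the path `P`, then the last vertex of `P`
precedes it. -/
theorem rel_of_attached (O : Obstruction D X A) (C : CycleOff X A P φ b s z)
    (H : Hole X A P φ ψ w) {y : α} (hy : y ∈ X w) {p : V} (hp : p ∈ P)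
    (h : Rel A (Function.update ψ w y) w p ∨ Rel A (Function.update ψ w y) p w) :
    Rel A (Function.update ψ w y) z w := by
  set χ := Function.update ψ w y with hχ
  have hmem : ∀ s, χ s ∈ X s := update_mem H.mem hy
  have hcrit : Crit A χ w := H.crit.update y
  have hPw : ∀ q ∈ P, q ≠ w := fun q hq => ne_of_mem_of_not_mem hq H.notMem
  have hχP : ∀ q ∈ P, χ q = φ q := fun q hq => by
    rw [hχ, Function.update_of_ne (hPw q hq), H.eq q hq]
  have hpc : Crit A χ p := by
    rcases h with h | h
    · exact O.crit_of_rel hmem hcrit h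
    · exact O.crit_of_rel_in hmem hcrit h
  -- Here q is the last vertex of P, in the order of φ, at which χ is critical. Its φ-successor can
  -- only be b, so q = z.
  obtain ⟨q, hq, hsink⟩ := C.crit {q | q ∈ P ∧ Crit A χ q}
    (fun q hq => ((C.mem_iff q).1 hq.1).2) ⟨p, hp, hpc⟩
  obtain ⟨r, hqr⟩ := O.exists_out C.mem ((C.mem_iff q).1 hq.1).1 (C.mem q)
  have hrc := O.crit_of_rel C.mem ((C.mem_iff q).1 hq.1).1 hqr
  have hrb : r = b := by
    by_contra hrb
    have hrP : r ∈ P := (C.mem_iff r).2 ⟨hrc, hrb⟩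
    have hrel : Rel A χ q r := by rw [Rel, hχP q hq.1, hχP r hrP]; exact hqr
    exact hsink r ⟨hrP, O.crit_of_rel hmem hq.2 hrel⟩ hqr
  subst hrb
  obtain rfl : q = z := O.rel_unique_in C.mem C.crit hqr C.rel_pred
  -- The χ-successor of z is not in P, since the φ-successor of z is b, and not elsewhere off w by
  -- `not_out`; so it is w.
  obtain ⟨r', hr'⟩ := O.exists_out hmem hq.2 (hmem q)
  by_cases hr'w : r' = w
  · exact hr'w ▸ hr'
  exfalso
  by_cases hr'P : r' ∈ P
  · have hrel : Rel A φ q r' := by rw [Rel, ← hχP q hq.1, ← hχP r' hr'P]; exact hr'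
    have := O.rel_unique C.mem ((C.mem_iff q).1 hq.1).1 hrel C.rel_pred
    subst this
    exact ((C.mem_iff r').1 hr'P).2 rfl
  · exact H.not_out q hq.1 r' hr'P hr'w ((rel_update_of_ne (hPw q hq.1) hr'w).1 hr')

open Classical in
theorem rel_of_attached_out (O : Obstruction D X A) (C : CycleOff X A P φ b s z)
    (H : Hole X A P φ ψ w) {y : α} (hy : y ∈ X w) {p : V} (hp : p ∈ P)
    (h : Rel A (Function.update ψ w y) w p ∨ Rel A (Function.update ψ w y) p w) :
    Rel A (Function.update ψ w y) w s :=
  O.flip.rel_of_attached C.flip H.flip hy hp h.symm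

open Classical in
-- Give w the color that leads to p. Then w is attached to P, so z precedes it and s follows it;
-- successors being unique, p = s.
theorem adj_of_attached (O : Obstruction D X A) (C : CycleOff X A P φ b s z)
    (H : Hole X A P φ ψ w) {p : V} (hp : p ∈ P) (h : D w p) : p = s ∧ D z w := by
  obtain ⟨y, hy, hA⟩ := O.exists_color_to H.mem H.crit h
  have hpw : p ≠ w := ne_of_mem_of_not_mem hp H.notMem
  have hrel := (rel_update_left (φ := ψ) (x := y) hpw).2 hA
  exact ⟨O.rel_unique (update_mem H.mem hy) (H.crit.update y) hrel
      (O.rel_of_attached_out C H hy hp (Or.inl hrel)),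
    O.cover.sub (O.rel_of_attached C H hy hp (Or.inl hrel))⟩

theorem adj_of_attached_in (O : Obstruction D X A) (C : CycleOff X A P φ b s z)
    (H : Hole X A P φ ψ w) {p : V} (hp : p ∈ P) (h : D p w) : p = z ∧ D w s :=
  O.flip.adj_of_attached C.flip H.flip hp h

open Classical in
-- Give w the color that leads to t. Were w attached to P, its unique successor would be s in P
-- instead of t; so P stays isolated and the uncolored vertex moves on to t.
theorem exists_hole_of_out (O : Obstruction D X A) (C : CycleOff X A P φ b s z)
    (H : Hole X A P φ ψ w) {t : V} (ht : t ∉ P) (h : D w t) : ∃ χ, Hole X A P φ χ t := by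
  obtain ⟨y, hy, hA⟩ := O.exists_color_to H.mem H.crit h
  have htw : t ≠ w := by rintro rfl; exact O.irrefl t h
  have hrel := (rel_update_left (φ := ψ) (x := y) htw).2 hA
  have hmem := update_mem H.mem hy
  have hcrit : Crit A (Function.update ψ w y) w := H.crit.update y
  have hPw : ∀ q ∈ P, q ≠ w := fun q hq => ne_of_mem_of_not_mem hq H.notMem
  have hatt : ∀ p ∈ P, ¬ (Rel A (Function.update ψ w y) w p ∨
      Rel A (Function.update ψ w y) p w) := by
    intro p hp hp'
    have := O.rel_unique hmem hcrit hrel (O.rel_of_attached_out C H hy hp hp')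
    exact ht (this ▸ O.succ_mem C)
  refine ⟨Function.update ψ w y, hmem, O.crit_of_rel hmem hcrit hrel, ht, ?_, ?_, ?_⟩
  · intro p hp
    rw [Function.update_of_ne (hPw p hp), H.eq p hp]
  · intro p hp q hq _ hpq
    by_cases hqw : q = w
    · subst hqw
      exact hatt p hp (Or.inr hpq)
    · exact H.not_out p hp q hq hqw ((rel_update_of_ne (hPw p hp) hqw).1 hpq)
  · intro p hp q hq _ hpq
    by_cases hqw : q = w
    · subst hqw
      exact hatt p hp (Or.inl hpq)
    · exact H.not_in p hp q hq hqw ((rel_update_of_ne hqw (hPw p hp)).1 hpq)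

theorem exists_hole_of_und (O : Obstruction D X A) (C : CycleOff X A P φ b s z)
    (H : Hole X A P φ ψ w) {t : V} (ht : t ∉ P) (h : Und D w t) : ∃ χ, Hole X A P φ χ t := by
  rcases h with h | h
  · exact O.exists_hole_of_out C H ht h
  · obtain ⟨χ, hχ⟩ := O.flip.exists_hole_of_out C.flip H.flip ht h
    exact ⟨χ, hχ.flip⟩

/-- If the lists have at least two colors, then some vertex off the cycle is adjacent to both
neighbors of `b` on the cycle. -/
theorem exists_attached (O : Obstruction D X A) (C : CycleOff X A P φ b s z)
    (hk : 2 ≤ (X b).card) :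
    ∃ w ψ, w ≠ b ∧ Hole X A P φ ψ w ∧ D w s ∧ D z w := by
  have hself := O.hole_self C
  -- With two colors, b has a second out-neighbor; it lies off P and lets the uncolored vertex leave
  -- b.
  obtain ⟨t, ht, hts⟩ : ∃ t, D b t ∧ t ≠ s := by
    by_contra! hcon
    have : {w | D b w}.ncard ≤ 1 := by
      rw [← ncard_singleton s]
      exact ncard_le_ncard (fun t ht => hcon t ht) (toFinite _)
    have := O.ncard_out b
    omega
  have htP : t ∉ P := fun htP => hts (O.adj_of_attached C hself htP ht).1
  have htb : t ≠ b := by rintro rfl; exact O.irrefl t ht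
  obtain ⟨χ, hχ⟩ := O.exists_hole_of_und C hself htP (Or.inl ht)
  have hsb : s ≠ b := ((C.mem_iff s).1 (O.succ_mem C)).2
  -- The vertices other than b that the uncolored vertex can reach with P frozen do not include s.
  -- An edge leaving this set in D - b must end in P, for otherwise the uncolored vertex could
  -- follow it.
  obtain ⟨a, ⟨hab, ψ, hψ⟩, c, hc, hac⟩ := O.conn_compl b {a | a ≠ b ∧ ∃ ψ, Hole X A P φ ψ a}
    (fun a ha => ha.1) ⟨t, htb, χ, hχ⟩
    ⟨s, hsb, fun h => h.2.elim fun ψ hψ => hψ.notMem (O.succ_mem C)⟩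
  have hcP : c ∈ P := by
    by_contra hcP
    exact hc.2 ⟨hc.1, O.exists_hole_of_und C hψ hcP hac⟩
  refine ⟨a, ψ, hab, hψ, ?_⟩
  rcases hac with h | h
  · obtain ⟨rfl, h'⟩ := O.adj_of_attached C hψ hcP h
    exact ⟨h, h'⟩
  · obtain ⟨rfl, h'⟩ := O.adj_of_attached_in C hψ hcP h
    exact ⟨h', h⟩

open Classical in
/-- If the lists have at least two colors, then the digraph is bidirected. -/
theorem symm_of_two_le (O : Obstruction D X A) {v u : V} (hk : 2 ≤ (X v).card) (h : D v u) :
    D u v := by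
  obtain ⟨φ₀, hφ₀, hc₀⟩ := O.exists_crit_vertex v
  obtain ⟨x, hx, hA⟩ := O.exists_color_to hφ₀ hc₀ h
  have huv : u ≠ v := by rintro rfl; exact O.irrefl u h
  obtain ⟨φ, hφ, hc, hvu⟩ : ∃ φ : V → α, (∀ s, φ s ∈ X s) ∧ Crit A φ v ∧ Rel A φ v u :=
    ⟨Function.update φ₀ v x, update_mem hφ₀ hx, hc₀.update x, (rel_update_left huv).2 hA⟩
  by_cases hcase : Rel A φ u v
  · exact O.cover.sub hcase
  exfalso
  have hcu := O.crit_of_rel hφ hc hvu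
  obtain ⟨z, hz⟩ := O.flip.exists_out hφ hc.flip (hφ v)
  obtain ⟨s, hs⟩ := O.exists_out hφ hcu (hφ u)
  have hcz := O.crit_of_rel_in hφ hc hz
  have hcs := O.crit_of_rel hφ hcu hs
  have Cv : CycleOff X A {p | Crit A φ p ∧ p ≠ v} φ v u z :=
    ⟨hφ, hc, fun _ => Iff.rfl, hvu, hz⟩
  have Cu : CycleOff X A {p | Crit A φ p ∧ p ≠ u} φ u s v :=
    ⟨hφ, hcu, fun _ => Iff.rfl, hs, hvu⟩
  -- The cycle of φ passes z, v, u, s, and w is off it. Starting from u instead of v, the uncolored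
  -- vertex can move to w, and the arc from z to w then forces an arc from w to s. From the
  -- viewpoint of v, an arc from w into the path must end at u, so s = u, which is absurd.
  obtain ⟨w, ψ, hwv, hw, hwu, hzw⟩ := O.exists_attached Cv hk
  have hwP : w ∉ {p | Crit A φ p ∧ p ≠ u} := fun h' => hw.notMem ⟨h'.1, hwv⟩
  obtain ⟨χ, hχ⟩ := O.exists_hole_of_und Cu (O.hole_self Cu) hwP (Or.inr hwu)
  have hzu : z ≠ u := by rintro rfl; exact hcase hz
  have hws := (O.adj_of_attached_in Cu hχ ⟨hcz, hzu⟩ hzw).2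
  have hsv : s ≠ v := by rintro rfl; exact hcase hs
  have hsu := (O.adj_of_attached Cv hw ⟨hcs, hsv⟩ hws).1
  exact O.ne hs hsu.symm

open Classical in
/-- In a bidirected obstruction, nonadjacent vertices with a common neighbor separate. -/
theorem not_conn_compl_pair (O : Obstruction D X A) {v a b : V} (hva : D v a) (hvb : D v b)
    (hab : a ≠ b) (hnot : ¬ Und D a b) : ¬ CutConn (Und D) ({a, b} : Set V)ᶜ := by
  intro hconn
  have hva' : v ≠ a := by rintro rfl; exact O.irrefl v hva
  have hvb' : v ≠ b := by rintro rfl; exact O.irrefl v hvb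
  obtain ⟨x, hx⟩ := O.nonempty v
  -- The colors s of a and t of b are both matched to the same color x of v, which would give x two
  -- out-neighbors.
  obtain ⟨s, hs, hAs⟩ := O.flip.exists_color_in hva hx
  obtain ⟨t, ht, hAt⟩ := O.flip.exists_color_in hvb hx
  let φ : V → α := Function.update (fun _ => t) a s
  have hφa : φ a = s := Function.update_self _ _ _
  have hφb : φ b = t := Function.update_of_ne hab.symm _ _
  have hac : Acyc (Rel A φ) {a, b} := by
    refine Acyc.insert_of_no_out ?_ (fun h => O.ne h rfl) ?_
    · exact acyc_singleton fun h => O.ne h rfl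
    · rintro _ rfl h
      exact hnot (Or.inl (O.cover.sub h))
  obtain ⟨ψ, h1, h2, h3⟩ := O.exists_crit (φ := φ) (S := {a, b}) (by
    rintro _ (rfl | rfl)
    · rwa [hφa]
    · rwa [hφb]) hac hconn (v := v) (by simp [hva', hvb'])
  refine hab (O.out_unique h2 h3 (x := x) (w := a) (w' := b) ?_ ?_)
  · rw [h1 a (Or.inl rfl), hφa]; exact hAs
  · rw [h1 b (Or.inr rfl), hφb]; exact hAt

end Obstruction

end Obstruction

/-! ### Graph lemmas: nonseparating pairs and recognition of cycles -/

section Graphs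

variable {V : Type*}

theorem exists_split {r : V → V → Prop} {S : Set V} (h : ¬ CutConn r S) :
    ∃ P ⊆ S, P.Nonempty ∧ (S \ P).Nonempty ∧ ∀ a ∈ P, ∀ b ∈ S, b ∉ P → ¬ r a b := by
  unfold CutConn at h
  push Not at h
  obtain ⟨P, hP, h1, h2, h3⟩ := h
  exact ⟨P, hP, h1, h2, fun a ha b hb hbP => h3 a ha b ⟨hb, hbP⟩⟩

/-- A union of sides of `U` at a cut vertex `c` contains a neighbor of `a` that does not separate
`U`, where `a` is the only vertex outside `U`. -/
theorem exists_leaf_vertex [Finite V] {r : V → V → Prop} (hr : ∀ a b, r a b → r b a) {a : V}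
    (h2 : ∀ v, CutConn r {v}ᶜ) (n : ℕ) : ∀ (c : V) (P : Set V), P.ncard = n → c ≠ a →
      c ∉ P → a ∉ P → P.Nonempty → (∀ p ∈ P, ∀ q, q ∉ P → q ≠ c → q ≠ a → ¬ r p q) →
      ∃ u ∈ P, r a u ∧ CutConn r ({a}ᶜ \ {u}) := by
  induction n using Nat.strong_induction_on with
  | _ n ih =>
  intro c P hn hca hcP haP hne hcut
  by_cases hall : ∀ u ∈ P, CutConn r ({a}ᶜ \ {u})
  · obtain ⟨p, hp, q, hq, hpq⟩ := h2 c P (fun x hx e => hcP (e ▸ hx)) hne ⟨a, hca.symm, haP⟩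
    have hqa : q = a := by
      by_contra hqa
      exact hcut p hp q hq.2 hq.1 hqa hpq
    exact ⟨p, hp, hr _ _ (hqa ▸ hpq), hall p hp⟩
  · push Not at hall
    obtain ⟨u, hu, hnot⟩ := hall
    have hua : u ≠ a := fun e => haP (e ▸ hu)
    have huc : u ≠ c := fun e => hcP (e ▸ hu)
    -- The part outside P and a is connected and contains c. Hence a side at u that misses c lies in
    -- P without u, and the induction continues there with cut vertex u.
    have hrest : CutConn r ({a}ᶜ \ P) := by
      have h3 := (h2 a).side hr (P := {a}ᶜ \ insert c P) (v := c) hca sdiff_subset ?_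
      · convert h3 using 1
        ext z
        simp only [mem_sdiff, mem_compl_iff, mem_singleton_iff, mem_insert_iff]
        by_cases hz : z = c
        · subst hz; simp [hca, hcP]
        · simp [hz]
      · intro x hx y hy hyP hyc hxy
        have hyP' : y ∈ P := by
          by_contra h
          exact hyP ⟨hy, by simp [h, hyc]⟩
        have hx2 := hx.2
        rw [mem_insert_iff, not_or] at hx2
        exact hcut y hyP' x hx2.2 hx2.1 hx.1 (hr _ _ hxy)
    have key : ∀ Q ⊆ ({a}ᶜ \ {u} : Set V), Q.Nonempty → c ∉ Q →
        (∀ x ∈ Q, ∀ y ∈ ({a}ᶜ \ {u} : Set V), y ∉ Q → ¬ r x y) →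
        ∃ u ∈ P, r a u ∧ CutConn r ({a}ᶜ \ {u}) := by
      intro Q hQ hQne hcQ hQcut
      have hQP : Q ⊆ P := by
        by_contra hQP
        obtain ⟨x, hx, hxP⟩ := not_subset.1 hQP
        obtain ⟨y, hy, z, hz, hyz⟩ := hrest (Q \ P) (fun x hx => ⟨(hQ hx.1).1, hx.2⟩)
          ⟨x, hx, hxP⟩ ⟨c, ⟨hca, hcP⟩, fun h => hcQ h.1⟩
        exact hQcut y hy.1 z ⟨hz.1.1, fun e => hz.1.2 ((show z = u from e) ▸ hu)⟩
          (fun h => hz.2 ⟨h, hz.1.2⟩) hyz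
      have hlt : Q.ncard < n := by
        rw [← hn]
        exact ncard_lt_ncard ⟨hQP, fun h => (hQ (h hu)).2 rfl⟩ (toFinite _)
      obtain ⟨u', hu', h4, h5⟩ := ih _ hlt u Q rfl hua (fun h => (hQ h).2 rfl)
        (fun h => (hQ h).1 rfl) hQne fun p hp q hq hqu hqa => hQcut p hp q ⟨hqa, hqu⟩ hq
      exact ⟨u', hQP hu', h4, h5⟩
    obtain ⟨Q, hQ, hQne, hQne', hQcut⟩ := exists_split hnot
    by_cases hcQ : c ∈ Q
    · exact key (({a}ᶜ \ {u}) \ Q) sdiff_subset hQne' (fun h => h.2 hcQ)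
        fun x hx y hy hyQ hxy => hQcut y (by_contra fun h => hyQ ⟨hy, h⟩) x hx.1 hx.2 (hr _ _ hxy)
    · exact key Q hQ hQne hcQ hQcut

/-- In a noncomplete graph without separating vertices and with minimum degree at least three, some
vertex has two nonadjacent neighbors that do not separate the graph. -/
theorem exists_nonadjacent_pair [Finite V] {r : V → V → Prop} (hr : ∀ a b, r a b → r b a)
    (h1 : CutConn r univ) (h2 : ∀ v, CutConn r {v}ᶜ)
    (h3 : ∀ v x y, ∃ z, r v z ∧ z ≠ v ∧ z ≠ x ∧ z ≠ y) {a₀ b₀ : V} (hne : a₀ ≠ b₀)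
    (hnot : ¬ r a₀ b₀) :
    ∃ v a b, r v a ∧ r v b ∧ a ≠ b ∧ ¬ r a b ∧ CutConn r ({a, b} : Set V)ᶜ := by
  -- An edge leaving the closed neighborhood of a₀ yields an induced path a₀, v, b.
  obtain ⟨v, hv, b, hb, hvb⟩ := h1 (insert a₀ {x | r a₀ x}) (subset_univ _)
    ⟨a₀, mem_insert _ _⟩ ⟨b₀, mem_univ _, by
      rintro (h | h)
      · exact hne h.symm
      · exact hnot h⟩
  have hb2 := hb.2
  rw [mem_insert_iff, not_or] at hb2
  have hav : r a₀ v := by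
    rcases hv with rfl | hv
    · exact absurd hvb hb2.2
    · exact hv
  by_cases hconn : CutConn r ({a₀, b} : Set V)ᶜ
  · exact ⟨v, a₀, b, hr _ _ hav, hvb, Ne.symm hb2.1, hb2.2, hconn⟩
  -- Now b is a cut vertex once a₀ is deleted. Each of the sides P and Q contains a neighbor of a₀
  -- that does not separate the graph without a₀; these two form the pair, with common neighbor a₀.
  obtain ⟨P, hP, hPne, hQne, hcut⟩ := exists_split hconn
  have hPa : a₀ ∉ P := fun h => hP h (Or.inl rfl)
  have hPb : b ∉ P := fun h => hP h (Or.inr rfl)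
  set Q := ({a₀, b} : Set V)ᶜ \ P with hQ
  have hmem : ∀ z, z ≠ a₀ → z ≠ b → z ∈ P ∨ z ∈ Q := by
    intro z hza hzb
    by_cases hz : z ∈ P
    · exact Or.inl hz
    · exact Or.inr ⟨by simp [hza, hzb], hz⟩
  have hPQ : ∀ p ∈ P, ∀ q ∈ Q, ¬ r p q := fun p hp q hq => hcut p hp q hq.1 hq.2
  have hQa : a₀ ∉ Q := fun h => h.1 (Or.inl rfl)
  have hQb : b ∉ Q := fun h => h.1 (Or.inr rfl)
  obtain ⟨x, hx, hax, hcx⟩ := exists_leaf_vertex hr h2 _ b P rfl hb2.1 hPb hPa hPne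
    fun p hp q hq hqb hqa => hPQ p hp q ((hmem q hqa hqb).resolve_left hq)
  obtain ⟨y, hy, hay, hcy⟩ := exists_leaf_vertex hr h2 _ b Q rfl hb2.1 hQb hQa hQne
    fun q hq p hp hpb hpa h => hPQ p ((hmem p hpa hpb).resolve_right hp) q hq (hr _ _ h)
  have hxQ : x ∉ Q := fun h => h.2 hx
  have hyP : y ∉ P := hy.2
  have hxy : x ≠ y := fun e => hyP (e ▸ hx)
  have hxa : x ≠ a₀ := fun e => hPa (e ▸ hx)
  have hya : y ≠ a₀ := fun e => hQa (e ▸ hy)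
  have hxb : x ≠ b := fun e => hPb (e ▸ hx)
  have hyb : y ≠ b := fun e => hQb (e ▸ hy)
  refine ⟨a₀, x, y, hax, hay, hxy, hPQ x hx y hy, ?_⟩
  have hmain : CutConn r ({a₀, x, y} : Set V)ᶜ := by
    refine CutConn.of_notMem hr (c := b) fun B hB hBne hbB => ?_
    have hBa : a₀ ∉ B := fun h => hB h (by simp)
    have hBx : x ∉ B := fun h => hB h (by simp)
    have hBy : y ∉ B := fun h => hB h (by simp)
    -- The edge obtained from deleting only a₀ and x' starts in P', so it cannot end in Q' and in
    -- particular avoids y'.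
    have side : ∀ P' Q' : Set V, ∀ x' y', a₀ ∉ P' → x' ∉ Q' → y' ∈ Q' → x' ∉ B → b ≠ x' →
        (∀ z, z ≠ a₀ → z ≠ b → z ∈ P' ∨ z ∈ Q') → (∀ p ∈ P', ∀ q ∈ Q', ¬ r p q) →
        CutConn r ({a₀}ᶜ \ {x'}) → (B ∩ P').Nonempty →
        ∃ s ∈ B, ∃ t, t ≠ a₀ ∧ t ≠ x' ∧ t ≠ y' ∧ t ∉ B ∧ r s t := by
      intro P' Q' x' y' haP' hxQ' hyQ' hxB hbx hcov hno hcon hBP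
      obtain ⟨s, hs, t, ht, hst⟩ := hcon (B ∩ P')
        (fun z hz => ⟨fun e => hBa ((show z = a₀ from e) ▸ hz.1),
          fun e => hxB ((show z = x' from e) ▸ hz.1)⟩) hBP
        ⟨b, ⟨hb2.1, hbx⟩, fun h => hbB h.1⟩
      have htQ : t ∉ Q' := fun h => hno s hs.2 t h hst
      refine ⟨s, hs.1, t, ht.1.1, ht.1.2, fun e => htQ (e ▸ hyQ'), fun htB => ?_, hst⟩
      have htb : t ≠ b := fun e => hbB (e ▸ htB)
      exact ht.2 ⟨htB, (hcov t ht.1.1 htb).resolve_right htQ⟩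
    obtain ⟨z, hz⟩ := hBne
    have hza : z ≠ a₀ := fun e => hBa (e ▸ hz)
    have hzb : z ≠ b := fun e => hbB (e ▸ hz)
    rcases hmem z hza hzb with hzP | hzQ
    · obtain ⟨s, hs, t, h4, h5, h6, h7, h8⟩ := side P Q x y hPa hxQ hy hBx hxb.symm hmem hPQ hcx
        ⟨z, hz, hzP⟩
      exact ⟨s, hs, t, ⟨by simp [h4, h5, h6], h7⟩, h8⟩
    · obtain ⟨s, hs, t, h4, h5, h6, h7, h8⟩ := side Q P y x hQa hyP hx hBy hyb.symm
        (fun z h h' => (hmem z h h').symm) (fun q hq p hp h => hPQ p hp q hq (hr _ _ h)) hcy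
        ⟨z, hz, hzQ⟩
      exact ⟨s, hs, t, ⟨by simp [h4, h5, h6], h7⟩, h8⟩
  -- A third neighbor reattaches a₀ after x and y are deleted.
  obtain ⟨z, haz, hza, hzx, hzy⟩ := h3 a₀ x y
  have := hmain.insert_adj hr (x := a₀) (s := z) (by simp [hza, hzx, hzy]) haz
  convert this using 1
  ext t
  simp only [mem_compl_iff, mem_insert_iff, mem_singleton_iff]
  by_cases ht : t = a₀
  · subst ht; simp [hxa.symm, hya.symm]
  · simp [ht]

/-- The orbit of a periodic point, as a cycle. -/
theorem exists_cycle_of_mem_periodicPts {f : V → V} {x : V} (hx : x ∈ Function.periodicPts f) :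
    ∃ p : ℕ, 0 < p ∧ ∃ c : ZMod p → V, Function.Injective c ∧ (∀ i, c (i + 1) = f (c i)) ∧
      c 0 = x := by
  have hp := Function.minimalPeriod_pos_of_mem_periodicPts hx
  have : NeZero (Function.minimalPeriod f x) := ⟨hp.ne'⟩
  refine ⟨Function.minimalPeriod f x, hp, fun i => f^[i.val] x, ?_, ?_, ?_⟩
  · intro i j hij
    exact ZMod.val_injective _ (Function.iterate_injOn_Iio_minimalPeriod
      (ZMod.val_lt i) (ZMod.val_lt j) hij)
  · intro i
    dsimp only
    rw [ZMod.val_add, ZMod.val_one_eq_one_mod, Nat.add_mod_mod,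
      Function.iterate_mod_minimalPeriod_eq, Function.iterate_succ_apply']
  · simp

theorem exists_mem_periodicPts [Finite V] (f : V → V) (x : V) :
    ∃ y, y ∈ Function.periodicPts f := by
  obtain ⟨m, n, hmn, h⟩ := Finite.exists_ne_map_eq_of_infinite fun n : ℕ => f^[n] x
  wlog hlt : m < n generalizing m n
  · exact this n m hmn.symm h.symm (by omega)
  refine ⟨f^[m] x, n - m, by omega, ?_⟩
  rw [Function.IsPeriodicPt, Function.IsFixedPt, ← Function.iterate_add_apply,
    Nat.sub_add_cancel hlt.le]
  exact h.symm

/-- A connected digraph with all out-degrees and in-degrees one is a directed cycle. -/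
theorem exists_directedCycle [Finite V] {D : V → V → Prop} (hD : ∀ v, ¬ D v v)
    (hconn : CutConn (Und D) univ) (v : V) (hout : ∀ v, {w | D v w}.ncard = 1)
    (hin : ∀ v, {w | D w v}.ncard = 1) :
    ∃ p : ℕ, 2 ≤ p ∧ ∃ c : ZMod p ≃ V, ∀ i j, D (c i) (c j) ↔ j = i + 1 := by
  have hex : ∀ v, ∃ w, {w | D v w} = {w} := fun v => ncard_eq_one.1 (hout v)
  choose f hf using hex
  have hDf : ∀ v w, D v w ↔ w = f v := fun v w => by
    have : w ∈ {w | D v w} ↔ w ∈ ({f v} : Set V) := by rw [hf]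
    exact this
  have hinj : ∀ u v w, D u w → D v w → u = v := by
    intro u v w hu hv
    obtain ⟨z, hz⟩ := ncard_eq_one.1 (hin w)
    have h1 : u ∈ {x | D x w} := hu
    have h2 : v ∈ {x | D x w} := hv
    rw [hz] at h1 h2
    exact h1.trans h2.symm
  obtain ⟨x, hx⟩ := exists_mem_periodicPts f v
  obtain ⟨p, hp, c, hc, hcf, -⟩ := exists_cycle_of_mem_periodicPts hx
  have hDc : ∀ i, D (c i) (c (i + 1)) := fun i => (hDf _ _).2 (hcf i)
  have hsurj : Function.Surjective c := by
    intro z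
    by_contra hz
    obtain ⟨a, ⟨i, rfl⟩, b, hb, hab⟩ := hconn (range c) (subset_univ _) ⟨c 0, 0, rfl⟩
      ⟨z, mem_univ _, hz⟩
    rcases hab with h | h
    · exact hb.2 ⟨i + 1, by rw [hcf, (hDf _ _).1 h]⟩
    · refine hb.2 ⟨i - 1, hinj _ _ (c i) ?_ h⟩
      have := hDc (i - 1)
      rwa [sub_add_cancel] at this
  refine ⟨p, ?_, Equiv.ofBijective c ⟨hc, hsurj⟩, fun i j => ?_⟩
  · by_contra hlt
    obtain rfl : p = 1 := by omega
    have := hDc 0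
    rw [Subsingleton.elim (0 + 1 : ZMod 1) 0] at this
    exact hD _ this
  · change D (c i) (c j) ↔ j = i + 1
    rw [hDf, ← hcf]
    exact hc.eq_iff

/-- A connected graph with all degrees two is a cycle. -/
theorem exists_cycleGraph_iso [Finite V] (G : SimpleGraph V) (hconn : CutConn G.Adj univ) (v : V)
    (hdeg : ∀ v, (G.neighborSet v).ncard = 2) :
    ∃ p : ℕ, 3 ≤ p ∧ Nonempty (SimpleGraph.cycleGraph p ≃g G) := by
  have hcyc : G.IsCycles := fun v _ => hdeg v
  have hne : (G.neighborSet v).Nonempty := nonempty_of_ncard_ne_zero (by rw [hdeg]; decide)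
  obtain ⟨w, hw, -⟩ := hcyc.exists_cycle_toSubgraph_verts_eq_connectedComponentSupp
    (c := G.connectedComponentMk v) rfl hne
  have h3 := hw.three_le_length
  obtain ⟨f⟩ := (SimpleGraph.cycleGraph_isContained_iff h3).2 ⟨v, w, hw, rfl⟩
  obtain ⟨n, hn⟩ : ∃ n, w.length = n + 3 := ⟨w.length - 3, by omega⟩
  rw [hn] at f
  have hinj : Function.Injective f := f.injective
  -- Both graphs are 2-regular, so the embedded cycle contains all neighbors of its vertices;
  -- connectedness then makes it spanning.
  have himg : ∀ i, f '' (SimpleGraph.cycleGraph (n + 3)).neighborSet i = G.neighborSet (f i) := by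
    intro i
    refine eq_of_subset_of_ncard_le ?_ ?_ (toFinite _)
    · rintro _ ⟨j, hj, rfl⟩
      exact f.toHom.map_adj hj
    · rw [hdeg, hinj.injOn.ncard_image, ← Nat.card_coe_set_eq, Nat.card_eq_fintype_card,
        SimpleGraph.card_neighborSet_eq_degree, SimpleGraph.cycleGraph_degree_three_le]
  have hadj : ∀ i z, G.Adj (f i) z → ∃ j, (SimpleGraph.cycleGraph (n + 3)).Adj i j ∧ f j = z := by
    intro i z hz
    have : z ∈ f '' (SimpleGraph.cycleGraph (n + 3)).neighborSet i := himg i ▸ hz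
    exact this
  have hsurj : Function.Surjective f := by
    intro z
    by_contra hz
    obtain ⟨a, ⟨i, rfl⟩, b, hb, hab⟩ := hconn (range f) (subset_univ _) ⟨f 0, 0, rfl⟩
      ⟨z, mem_univ _, hz⟩
    obtain ⟨j, -, hj⟩ := hadj i b hab
    exact hb.2 ⟨j, hj⟩
  refine ⟨n + 3, by omega,
    ⟨⟨Equiv.ofBijective f ⟨hinj, hsurj⟩, fun {i j} => ⟨fun h => ?_, fun h => ?_⟩⟩⟩⟩
  · obtain ⟨k, hk, hkj⟩ := hadj i (f j) h
    exact hinj hkj ▸ hk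
  · exact f.toHom.map_adj h

/-- The structure of a digraph without separating vertices that has an obstruction. -/
theorem Obstruction.classify [Finite V] {α : Type*} {D : V → V → Prop} {X : V → Finset α}
    {A : V → α → V → α → Prop} (O : Obstruction D X A) (v : V) :
    (∃ p : ℕ, 2 ≤ p ∧ ∃ c : ZMod p ≃ V, ∀ i j, D (c i) (c j) ↔ j = i + 1) ∨
    (∃ G : SimpleGraph V, (∀ a b, D a b ↔ G.Adj a b) ∧
      ∃ p : ℕ, 3 ≤ p ∧ Nonempty (SimpleGraph.cycleGraph p ≃g G)) ∨
    ∀ a b, D a b ↔ a ≠ b := by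
  have hpos : 0 < (X v).card := (O.nonempty v).card_pos
  have hout : ∀ u, {w | D u w}.ncard = (X v).card := fun u => by
    rw [O.ncard_out u, O.card_eq u v]
  have hin : ∀ u, {w | D w u}.ncard = (X v).card := fun u => by
    rw [O.flip.ncard_out u, O.card_eq u v]
  rcases Nat.lt_or_ge (X v).card 2 with hlt | hk
  · have h1 : (X v).card = 1 := by omega
    rw [h1] at hout hin
    exact Or.inl (exists_directedCycle O.irrefl O.conn v hout hin)
  have hsymm : ∀ a b, D a b → D b a := fun a b h =>
    O.symm_of_two_le (by rw [O.card_eq a v]; exact hk) h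
  have hund : ∀ a b, Und D a b ↔ D a b := fun a b => ⟨fun h => h.elim id (hsymm b a), Or.inl⟩
  have hund' : Und D = D := by
    funext a b; exact propext (hund a b)
  refine Or.inr ?_
  by_cases hcomp : ∀ a b, D a b ↔ a ≠ b
  · exact Or.inr hcomp
  refine Or.inl ?_
  rcases hk.eq_or_lt with h2 | h3
  · let G : SimpleGraph V := ⟨D, ⟨fun a b h => hsymm a b h⟩, ⟨O.irrefl⟩⟩
    refine ⟨G, fun _ _ => Iff.rfl, exists_cycleGraph_iso G ?_ v fun u => ?_⟩
    · have := O.conn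
      rwa [hund'] at this
    · exact (hout u).trans h2.symm
  · exfalso
    obtain ⟨a, b, hne, hnot⟩ : ∃ a b, a ≠ b ∧ ¬ D a b := by
      push Not at hcomp
      obtain ⟨a, b, h⟩ := hcomp
      rcases h with ⟨h, h'⟩ | ⟨h, h'⟩
      · subst h'; exact absurd h (O.irrefl a)
      · exact ⟨a, b, h', h⟩
    have hconn := O.conn
    have hcompl := O.conn_compl
    rw [hund'] at hconn hcompl
    have hthree : ∀ u x y, ∃ z, D u z ∧ z ≠ u ∧ z ≠ x ∧ z ≠ y := by
      intro u x y
      have hcard : ({x, y} : Set V).ncard < {w | D u w}.ncard := by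
        rw [hout]
        have h1 := ncard_insert_le x {y}
        rw [ncard_singleton] at h1
        omega
      obtain ⟨z, hz, hz'⟩ := exists_mem_notMem_of_ncard_lt_ncard hcard (toFinite _)
      rw [mem_insert_iff, mem_singleton_iff, not_or] at hz'
      refine ⟨z, hz, ?_, hz'.1, hz'.2⟩
      rintro rfl
      exact O.irrefl z hz
    obtain ⟨u, x, y, hux, huy, hxy, hnot', hc⟩ :=
      exists_nonadjacent_pair hsymm hconn hcompl hthree hne hnot
    exact O.not_conn_compl_pair hux huy hxy (by rwa [hund']) (by rwa [hund'])

end Graphs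

/-! ### Decomposition into maximal nonseparable sets -/

section Blocks

variable {V : Type*}

/-- The digraph is a directed cycle, a bidirected cycle, or a bidirected complete graph. -/
def Brick (D : V → V → Prop) : Prop :=
  (∃ p : ℕ, 2 ≤ p ∧ ∃ c : ZMod p ≃ V, ∀ i j, D (c i) (c j) ↔ j = i + 1) ∨
  (∃ G : SimpleGraph V, (∀ a b, D a b ↔ G.Adj a b) ∧
    ∃ p : ℕ, 3 ≤ p ∧ Nonempty (SimpleGraph.cycleGraph p ≃g G)) ∨
  ∀ a b, D a b ↔ a ≠ b

theorem cutConn_image {D : V → V → Prop} {S : Set V} {B : Set S} :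
    CutConn (Und fun a b : S => D a b) B ↔ CutConn (Und D) (Subtype.val '' B) := by
  constructor
  · intro h A hA hne hne'
    obtain ⟨a, ha⟩ := hne
    obtain ⟨b, hb, hbA⟩ := hne'
    obtain ⟨a', ha', rfl⟩ := hA ha
    obtain ⟨b', hb', rfl⟩ := hb
    obtain ⟨x, hx, y, hy, hxy⟩ := h (Subtype.val ⁻¹' A ∩ B) inter_subset_right ⟨a', ha, ha'⟩
      ⟨b', hb', fun h => hbA h.1⟩
    exact ⟨x, hx.1, y, ⟨mem_image_of_mem _ hy.1, fun h => hy.2 ⟨h, hy.1⟩⟩, hxy⟩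
  · intro h A hA hne hne'
    obtain ⟨a, ha⟩ := hne
    obtain ⟨b, hb, hbA⟩ := hne'
    obtain ⟨_, ⟨x, hx, rfl⟩, _, ⟨⟨y, hy, rfl⟩, hyA⟩, hxy⟩ := h (Subtype.val '' A)
      (image_mono hA) ⟨a, mem_image_of_mem _ ha⟩
      ⟨b, mem_image_of_mem _ hb, fun ⟨b', hb', e⟩ => hbA (Subtype.ext e ▸ hb')⟩
    exact ⟨x, hx, y, ⟨hy, fun h => hyA (mem_image_of_mem _ h)⟩, hxy⟩

theorem cutConn_subtype_univ {D : V → V → Prop} {S : Set V} :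
    CutConn (Und fun a b : S => D a b) univ ↔ CutConn (Und D) S := by
  rw [cutConn_image, image_univ, Subtype.range_coe]

theorem image_val_compl_singleton {S : Set V} (v : S) :
    Subtype.val '' ({v}ᶜ : Set S) = S \ {(v : V)} := by
  ext z
  constructor
  · rintro ⟨x, hx, rfl⟩
    exact ⟨x.2, fun e => hx (Subtype.ext e)⟩
  · rintro ⟨h, h'⟩
    exact ⟨⟨z, h⟩, fun e => h' (congrArg Subtype.val e), rfl⟩

theorem outdeg_subtype {D : V → V → Prop} {S : Set V} (v : S) :
    outdeg (fun a b : S => D a b) univ v = outdeg D S v := by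
  unfold outdeg
  rw [← ncard_image_of_injective _ (Subtype.val_injective (p := fun x => x ∈ S))]
  congr 1
  ext z
  constructor
  · rintro ⟨x, hx, rfl⟩
    exact ⟨x.2, hx.2⟩
  · rintro ⟨h, h'⟩
    exact ⟨⟨z, h⟩, ⟨mem_univ _, h'⟩, rfl⟩

open Classical in
theorem Uncolorable.exists_obstruction [Finite V] {α : Type*} {D : V → V → Prop} {S : Set V}
    (hD : ∀ v, ¬ D v v) (hS : Nonsep D S) (hnt : S.Nontrivial) (h : Uncolorable D α S) :
    ∃ (X : S → Finset α) (A : S → α → S → α → Prop),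
      Obstruction (fun a b : S => D a b) X A := by
  obtain ⟨X, A, hA, hX, hun⟩ := h
  refine ⟨fun v => X v, fun a x b y => A a x b y, fun v => hD v, ⟨hA.sub, hA.injl, hA.injr⟩,
    ?_, ?_, cutConn_subtype_univ.2 hS.2.1, ?_, ?_⟩
  · intro v _
    rw [outdeg_subtype, outdeg_subtype (D := fun a b => D b a)]
    exact hX v v.2
  · intro φ hφ hac
    obtain ⟨s, hs⟩ := hS.1
    let ψ : V → α := fun v => if h : v ∈ S then φ ⟨v, h⟩ else φ ⟨s, hs⟩
    have hψ : ∀ v : S, ψ v = φ v := fun v => dif_pos v.2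
    refine hun ψ (fun v hv => ?_) ?_
    · rw [hψ ⟨v, hv⟩]; exact hφ _
    · intro B hB hne
      obtain ⟨b, hb⟩ := hne
      obtain ⟨a, ha, h⟩ := hac (Subtype.val ⁻¹' B) (subset_univ _) ⟨⟨b, hB hb⟩, hb⟩
      refine ⟨a, ha, fun c hc hac => h ⟨c, hB hc⟩ hc ?_⟩
      rwa [Rel, hψ a, hψ ⟨c, hB hc⟩] at hac
  · intro v
    rw [cutConn_image, image_val_compl_singleton]
    exact hS.2.2 v v.2
  -- Nontriviality gives v a neighbor in S, hence a positive degree and a nonempty list.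
  · intro v
    obtain ⟨w, hw, hwv⟩ := hnt.exists_ne v
    obtain ⟨a, ha, b, hb, hab⟩ := hS.2.1 {(v : V)} (by simp) ⟨v, rfl⟩ ⟨w, hw, hwv⟩
    rw [mem_singleton_iff] at ha
    subst ha
    rw [← Finset.card_pos]
    rcases hab with h | h
    · refine lt_of_lt_of_le ?_ (hX v v.2).1
      exact (ncard_pos (toFinite _)).2 ⟨b, hb.1, h⟩
    · refine lt_of_lt_of_le ?_ (hX v v.2).2
      exact (ncard_pos (toFinite _)).2 ⟨b, hb.1, h⟩

theorem cutConn_of_subsingleton {r : V → V → Prop} {S : Set V} (h : S.Subsingleton) :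
    CutConn r S := by
  rintro A hA ⟨a, ha⟩ ⟨b, hb⟩
  exact absurd (h (hA ha) hb.1 ▸ ha) hb.2

theorem nonsep_pair {D : V → V → Prop} {v w : V} (h : Und D v w) : Nonsep D {v, w} := by
  refine ⟨⟨v, Or.inl rfl⟩, ?_, ?_⟩
  · exact (cutConn_of_subsingleton subsingleton_singleton).insert_adj Und.symm
      (mem_singleton w) h
  · rintro x (rfl | rfl)
    all_goals
      refine cutConn_of_subsingleton ?_
      rintro a ⟨rfl | rfl, ha⟩ b ⟨rfl | rfl, hb⟩ <;> simp_all

/-- A connected set with a separating vertex splits at this vertex. -/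
theorem exists_meetAt [Finite V] {D : V → V → Prop} {S : Set V} (hne : S.Nonempty)
    (hS : CutConn (Und D) S) (hnot : ¬ Nonsep D S) :
    ∃ S₁ S₂ v, MeetAt D S₁ S₂ v ∧ S₁ ∪ S₂ = S ∧ CutConn (Und D) S₁ ∧ CutConn (Und D) S₂ ∧
      S₁.ncard < S.ncard ∧ S₂.ncard < S.ncard ∧ S₁.Nontrivial ∧ S₂.Nontrivial := by
  obtain ⟨v, hv, hcut⟩ : ∃ v ∈ S, ¬ CutConn (Und D) (S \ {v}) := by
    by_contra! h
    exact hnot ⟨hne, hS, h⟩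
  obtain ⟨P, hP, ⟨p, hp⟩, ⟨q, hq, hqP⟩, hPQ⟩ := exists_split hcut
  have hvP : v ∉ P := fun h => (hP h).2 rfl
  have hpv : p ≠ v := fun e => hvP (e ▸ hp)
  have hmem : ∀ a, a ∈ insert v ((S \ {v}) \ P) → a ∈ S ∧ a ∉ P := by
    rintro a (rfl | h)
    · exact ⟨hv, hvP⟩
    · exact ⟨h.1.1, h.2⟩
  have hmem' : ∀ a ∈ insert v P, a ∈ S := by
    rintro a (rfl | h)
    · exact hv
    · exact (hP h).1
  refine ⟨insert v P, insert v ((S \ {v}) \ P), v, ⟨mem_insert _ _, mem_insert _ _, ?_, ?_⟩, ?_,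
    ?_, ?_, ?_, ?_, ?_, ?_⟩
  · rintro a (rfl | ha) ha'
    · rfl
    · exact absurd ha (hmem a ha').2
  · intro a ha b hb hav hbv
    have hbQ := hb.resolve_left hbv
    exact hPQ a (ha.resolve_left hav) b hbQ.1 hbQ.2
  · ext a
    constructor
    · rintro (h | h)
      · exact hmem' a h
      · exact (hmem a h).1
    · intro h
      by_cases hav : a = v
      · exact Or.inl (Or.inl hav)
      · by_cases haP : a ∈ P
        · exact Or.inl (Or.inr haP)
        · exact Or.inr (Or.inr ⟨⟨h, hav⟩, haP⟩)
  · exact hS.side Und.symm hv (fun a ha => (hP ha).1)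
      fun a ha b hb hbP hbv => hPQ a ha b ⟨hb, hbv⟩ hbP
  · refine hS.side Und.symm hv (fun a ha => ha.1.1) fun a ha b hb hbQ hbv hab => ?_
    have hbP : b ∈ P := by
      by_contra h
      exact hbQ ⟨⟨hb, hbv⟩, h⟩
    exact hPQ b hbP a ha.1 ha.2 hab.symm
  · refine ncard_lt_ncard ⟨hmem', fun h => ?_⟩ (toFinite _)
    exact (h hq.1).elim hq.2 hqP
  · refine ncard_lt_ncard ⟨fun a ha => (hmem a ha).1, fun h => ?_⟩ (toFinite _)
    exact (hmem p (h (hP hp).1)).2 hp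
  · exact ⟨p, Or.inr hp, v, Or.inl rfl, hpv⟩
  · exact ⟨q, Or.inr ⟨hq, hqP⟩, v, Or.inl rfl, hq.2⟩

/-- Otherwise deleting v would disconnect B. -/
theorem MeetAt.subset_or_subset {D : V → V → Prop} {S T B : Set V} {v : V}
    (hm : MeetAt D S T v) (hB : Nonsep D B) (hBST : B ⊆ S ∪ T) : B ⊆ S ∨ B ⊆ T := by
  by_contra! hcon
  obtain ⟨x, hx, hxS⟩ := not_subset.1 hcon.1
  obtain ⟨y, hy, hyT⟩ := not_subset.1 hcon.2
  have hconn : CutConn (Und D) (B \ {v}) := by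
    by_cases hv : v ∈ B
    · exact hB.2.2 v hv
    · rw [sdiff_singleton_eq_self hv]; exact hB.2.1
  obtain ⟨a, ha, b, hb, hab⟩ := hconn ((B \ {v}) ∩ S) inter_subset_left
    ⟨y, ⟨hy, fun e => hyT ((show y = v from e) ▸ hm.right)⟩, (hBST hy).resolve_right hyT⟩
    ⟨x, ⟨hx, fun e => hxS ((show x = v from e) ▸ hm.left)⟩, fun h => hxS h.2⟩
  have hbS : b ∉ S := fun h => hb.2 ⟨hb.1, h⟩
  exact hm.not_und a ha.2 b ((hBST hb.1.1).resolve_left hbS) ha.1.2 hb.1.2 hab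

/-- A nonseparable extension of B inside T would force B ⊆ {v}. But v has a neighbor w in S, and the
nonseparable pair {v, w} would then be larger than B. -/
theorem MeetAt.maximal_left {D : V → V → Prop} {S T B : Set V} {v : V} (hm : MeetAt D S T v)
    (hS : CutConn (Und D) S) (hnt : S.Nontrivial)
    (hB : Maximal (fun B => Nonsep D B ∧ B ⊆ S) B) :
    Maximal (fun B => Nonsep D B ∧ B ⊆ S ∪ T) B := by
  refine ⟨⟨hB.prop.1, hB.prop.2.trans subset_union_left⟩, fun C hC hBC => ?_⟩
  rcases hm.subset_or_subset hC.1 hC.2 with h | h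
  · exact hB.le_of_ge ⟨hC.1, h⟩ hBC
  · exfalso
    have hBv : ∀ b ∈ B, b = v := fun b hb => hm.eq_of_mem b (hB.prop.2 hb) (h (hBC hb))
    obtain ⟨s, hs, hsv⟩ := hnt.exists_ne v
    obtain ⟨a, ha, w, hw, haw⟩ := hS {v} (by simpa using hm.left) ⟨v, rfl⟩ ⟨s, hs, hsv⟩
    rw [mem_singleton_iff] at ha
    subst ha
    have hle := hB.le_of_ge (y := {a, w})
      ⟨nonsep_pair haw, by rintro _ (rfl | rfl); exacts [hm.left, hw.1]⟩
      (fun b hb => Or.inl (hBv b hb))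
    exact hw.2 (hBv w (hle (Or.inr rfl)))

theorem brick_of_uncolorable [Finite V] {α : Type*} {D : V → V → Prop} (hD : ∀ v, ¬ D v v)
    (n : ℕ) : ∀ S : Set V, S.ncard = n → S.Nonempty → CutConn (Und D) S → Uncolorable D α S →
      ∀ B, Maximal (fun B => Nonsep D B ∧ B ⊆ S) B → Brick fun a b : B => D a b := by
  induction n using Nat.strong_induction_on with
  | _ n ih =>
  intro S hn hne hS hun B hB
  by_cases hsep : Nonsep D S
  · obtain rfl : B = S := hB.prop.2.antisymm (hB.le_of_ge ⟨hsep, subset_rfl⟩ hB.prop.2)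
    rcases B.subsingleton_or_nontrivial with hs | hnt
    · refine Or.inr (Or.inr fun a b => ?_)
      obtain rfl : a = b := Subtype.ext (hs a.2 b.2)
      simp [hD]
    · obtain ⟨X, A, O⟩ := hun.exists_obstruction hD hsep hnt
      exact O.classify ⟨_, hne.some_mem⟩
  · obtain ⟨S₁, S₂, v, hm, rfl, h1, h2, hlt1, hlt2, -, -⟩ := exists_meetAt hne hS hsep
    rcases hm.subset_or_subset hB.prop.1 hB.prop.2 with h | h
    · exact ih _ (hn ▸ hlt1) S₁ rfl ⟨v, hm.left⟩ h1 (hun.left hD hm h2) B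
        ⟨⟨hB.prop.1, h⟩, fun C hC => hB.le_of_ge ⟨hC.1, hC.2.trans subset_union_left⟩⟩
    · refine ih _ (hn ▸ hlt2) S₂ rfl ⟨v, hm.right⟩ h2 ?_ B
        ⟨⟨hB.prop.1, h⟩, fun C hC => hB.le_of_ge ⟨hC.1, hC.2.trans subset_union_right⟩⟩
      rw [union_comm] at hun
      exact hun.left hD hm.symm h1

theorem uncolorable_of_brick [Finite V] {D : V → V → Prop} {S : Set V} (hne : S.Nonempty)
    (h : Brick fun a b : S => D a b) : ∃ α : Type, Uncolorable D α S := by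
  rcases h with ⟨p, -, c, hc⟩ | ⟨G, hG, p, hp, ⟨e⟩⟩ | h
  · exact ⟨Unit, uncolorable_of_directedCycle c hc⟩
  · obtain ⟨n, rfl⟩ : ∃ n, p = n + 3 := ⟨p - 3, by omega⟩
    exact ⟨Bool, uncolorable_of_bidirectedCycle e.toEquiv
      fun i j => (hG _ _).trans e.map_adj_iff⟩
  · refine ⟨_, uncolorable_of_complete hne fun a ha b hb => ?_⟩
    exact (h ⟨a, ha⟩ ⟨b, hb⟩).trans (by rw [Ne, Subtype.mk.injEq])

theorem uncolorable_of_bricks [Finite V] {D : V → V → Prop} (hD : ∀ v, ¬ D v v)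
    (n : ℕ) : ∀ S : Set V, S.ncard = n → S.Nonempty → CutConn (Und D) S →
      (∀ B, Maximal (fun B => Nonsep D B ∧ B ⊆ S) B → Brick fun a b : B => D a b) →
      ∃ α : Type, Uncolorable D α S := by
  induction n using Nat.strong_induction_on with
  | _ n ih =>
  intro S hn hne hS hB
  by_cases hsep : Nonsep D S
  · exact uncolorable_of_brick hne (hB S ⟨⟨hsep, subset_rfl⟩, fun C hC _ => hC.2⟩)
  · obtain ⟨S₁, S₂, v, hm, rfl, h1, h2, hlt1, hlt2, hnt1, hnt2⟩ := exists_meetAt hne hS hsep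
    obtain ⟨α, hα⟩ := ih _ (hn ▸ hlt1) S₁ rfl ⟨v, hm.left⟩ h1
      fun B h => hB B (hm.maximal_left h1 hnt1 h)
    obtain ⟨β, hβ⟩ := ih _ (hn ▸ hlt2) S₂ rfl ⟨v, hm.right⟩ h2
      fun B h => hB B (by rw [union_comm]; exact hm.symm.maximal_left h2 hnt2 h)
    exact ⟨α ⊕ β, hα.union hD hm hβ⟩

end Blocks

/-! ### Translation to digraphs, blocks and covers -/

section Bridges

variable {V : Type*}

theorem preconnected_iff_cutConn (G : SimpleGraph V) : G.Preconnected ↔ CutConn G.Adj univ := by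
  constructor
  · intro h A _ hne hne'
    obtain ⟨a, ha⟩ := hne
    obtain ⟨b, -, hb⟩ := hne'
    obtain ⟨p⟩ := h a b
    obtain ⟨d, -, h1, h2⟩ := p.exists_boundary_dart A ha hb
    exact ⟨d.fst, h1, d.snd, ⟨mem_univ _, h2⟩, d.adj⟩
  · intro h a b
    by_contra hab
    obtain ⟨x, hx, y, hy, hxy⟩ := h {x | G.Reachable a x} (subset_univ _) ⟨a, .refl _⟩
      ⟨b, mem_univ _, hab⟩
    exact hy.2 (SimpleGraph.Reachable.trans hx hxy.reachable)

theorem inclusive_preconnected_iff (E : Digraph V) :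
    E.toSimpleGraphInclusive.Preconnected ↔ CutConn (Und E.Adj) univ := by
  rw [preconnected_iff_cutConn]
  constructor
  · intro h A hA hne hne'
    obtain ⟨a, ha, b, hb, hab⟩ := h A hA hne hne'
    exact ⟨a, ha, b, hb, hab.2⟩
  · intro h A hA hne hne'
    obtain ⟨a, ha, b, hb, hab⟩ := h A hA hne hne'
    exact ⟨a, ha, b, hb, fun e => hb.2 (e ▸ ha), hab⟩

theorem isSeparatingVertex_iff (E : Digraph V) (v : V) :
    E.IsSeparatingVertex v ↔ ¬ CutConn (Und E.Adj) {v}ᶜ := by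
  rw [Digraph.IsSeparatingVertex, inclusive_preconnected_iff]
  exact not_congr cutConn_subtype_univ

theorem nonsep_iff {R : V → V → Prop} {S : Set V} (E : Digraph S)
    (hE : ∀ a b : S, E.Adj a b ↔ R a b) :
    (E.IsConnected ∧ ∀ v, ¬ E.IsSeparatingVertex v) ↔ Nonsep R S := by
  have hadj : E.Adj = fun a b : S => R a b := by
    funext a b; exact propext (hE a b)
  have hsep : ∀ v, ¬ E.IsSeparatingVertex v ↔ CutConn (Und R) (S \ {(v : V)}) := by
    intro v
    rw [isSeparatingVertex_iff, not_not, hadj, cutConn_image, image_val_compl_singleton]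
  rw [Digraph.IsConnected, SimpleGraph.connected_iff, inclusive_preconnected_iff, hadj,
    cutConn_subtype_univ, nonempty_coe_sort]
  constructor
  · rintro ⟨⟨h1, h2⟩, h3⟩
    exact ⟨h2, h1, fun v hv => (hsep ⟨v, hv⟩).1 (h3 _)⟩
  · rintro ⟨h1, h2, h3⟩
    exact ⟨⟨h2, h1⟩, fun v => (hsep v).2 (h3 v v.2)⟩

theorem CutConn.mono_rel {r r' : V → V → Prop} {S : Set V} (h : CutConn r S)
    (hr : ∀ a b, r a b → r' a b) : CutConn r' S := by
  intro A hA hne hne'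
  obtain ⟨a, ha, b, hb, hab⟩ := h A hA hne hne'
  exact ⟨a, ha, b, hb, hr _ _ hab⟩

theorem Nonsep.mono_rel {R R' : V → V → Prop} {S : Set V} (h : Nonsep R S)
    (hr : ∀ a b, R a b → R' a b) : Nonsep R' S :=
  ⟨h.1, h.2.1.mono_rel fun _ _ => Or.imp (hr _ _) (hr _ _),
    fun v hv => (h.2.2 v hv).mono_rel fun _ _ => Or.imp (hr _ _) (hr _ _)⟩

/-- The induced subdigraph, as a subdigraph. -/
def inducedSub (D : Digraph V) (S : Set V) : Digraph.Subdigraph D where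
  verts := S
  Adj a b := a ∈ S ∧ b ∈ S ∧ D.Adj a b
  adj_sub h := h.2.2
  left_mem h := h.1
  right_mem h := h.2.1

theorem le_inducedSub {D : Digraph V} (B : Digraph.Subdigraph D) : B ≤ inducedSub D B.verts :=
  ⟨subset_rfl, fun _ _ h => ⟨B.left_mem h, B.right_mem h, B.adj_sub h⟩⟩

theorem nonsep_inducedSub_iff {D : Digraph V} {S : Set V} :
    ((inducedSub D S).toDigraph.IsConnected ∧
      ∀ v, ¬ (inducedSub D S).toDigraph.IsSeparatingVertex v) ↔ Nonsep D.Adj S :=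
  nonsep_iff (inducedSub D S).toDigraph fun a b => ⟨fun h => h.2.2, fun h => ⟨a.2, b.2, h⟩⟩

theorem nonsep_verts {D : Digraph V} {B : Digraph.Subdigraph D}
    (h : B.toDigraph.IsConnected ∧ ∀ v, ¬ B.toDigraph.IsSeparatingVertex v) :
    Nonsep D.Adj B.verts :=
  ((nonsep_iff B.toDigraph fun _ _ => Iff.rfl).1 h).mono_rel fun _ _ h => B.adj_sub h

/-- The blocks are the subdigraphs induced by the maximal nonseparable sets. -/
theorem isBlock_iff {D : Digraph V} {B : Digraph.Subdigraph D} :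
    D.IsBlock B ↔ ∃ S, Maximal (fun S => Nonsep D.Adj S ∧ S ⊆ univ) S ∧ B = inducedSub D S := by
  constructor
  · intro h
    have hns := nonsep_verts h.prop
    refine ⟨B.verts, ⟨⟨hns, subset_univ _⟩, fun C hC hBC => ?_⟩, ?_⟩
    · have hle : B ≤ inducedSub D C := (le_inducedSub B).trans
        ⟨hBC, fun _ _ h => ⟨hBC h.1, hBC h.2.1, h.2.2⟩⟩
      exact (h.le_of_ge (nonsep_inducedSub_iff.2 hC.1) hle).1
    · exact le_antisymm (le_inducedSub B)
        (h.le_of_ge (nonsep_inducedSub_iff.2 hns) (le_inducedSub B))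
  · rintro ⟨S, hS, rfl⟩
    refine ⟨nonsep_inducedSub_iff.2 hS.prop.1, fun C hC hSC => ?_⟩
    have hle : C.verts ⊆ S := hS.le_of_ge ⟨nonsep_verts hC, subset_univ _⟩ hSC.1
    exact ⟨hle, fun _ _ h => ⟨hle (C.left_mem h), hle (C.right_mem h), C.adj_sub h⟩⟩

theorem brick_iff (E : Digraph V) :
    (E.IsDirectedCycle ∨ E.IsBidirectedCycle ∨ E.IsBidirectedComplete) ↔ Brick E.Adj := by
  refine or_congr Iff.rfl (or_congr ?_ ?_)
  · refine exists_congr fun G => and_congr ?_ Iff.rfl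
    constructor
    · rintro rfl a b
      rfl
    · intro h
      ext a b
      exact h a b
  · constructor
    · intro h a b
      rw [show E = _ from h]
      rfl
    · intro h
      change E = Digraph.ofSimpleGraph ⊤
      ext a b
      exact h a b

theorem forall_block_iff (D : Digraph V) :
    (∀ B : Digraph.Subdigraph D, D.IsBlock B → B.toDigraph.IsDirectedCycle ∨
      B.toDigraph.IsBidirectedCycle ∨ B.toDigraph.IsBidirectedComplete) ↔
    ∀ S, Maximal (fun S => Nonsep D.Adj S ∧ S ⊆ univ) S → Brick fun a b : S => D.Adj a b := by
  have hadj : ∀ S, (inducedSub D S).toDigraph.Adj = fun a b : S => D.Adj a b := by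
    intro S
    funext a b
    exact propext ⟨fun h => h.2.2, fun h => ⟨a.2, b.2, h⟩⟩
  constructor
  · intro h S hS
    rw [← hadj]
    exact (brick_iff _).1 (h _ (isBlock_iff.2 ⟨S, hS, rfl⟩))
  · intro h B hB
    obtain ⟨S, hS, rfl⟩ := isBlock_iff.1 hB
    refine (brick_iff _).2 ?_
    rw [hadj]
    exact h S hS

theorem exists_directedCycle_of_not_acyc [Finite V] {R : V → V → Prop} (hR : ∀ v, ¬ R v v)
    (h : ¬ Acyc R univ) : ∃ p : ℕ, 2 ≤ p ∧ ∃ c : ZMod p → V, Function.Injective c ∧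
      ∀ i, R (c i) (c (i + 1)) := by
  unfold Acyc at h
  push Not at h
  obtain ⟨S, -, ⟨s, hs⟩, hS⟩ := h
  choose f hf hRf using hS
  let g : S → S := fun a => ⟨f a a.2, hf a a.2⟩
  obtain ⟨x, hx⟩ := exists_mem_periodicPts g ⟨s, hs⟩
  obtain ⟨p, hp, c, hc, hcg, -⟩ := exists_cycle_of_mem_periodicPts hx
  have hRc : ∀ i, R (c i) (c (i + 1)) := fun i => by
    rw [hcg]; exact hRf _ _
  refine ⟨p, ?_, fun i => c i, Subtype.val_injective.comp hc, hRc⟩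
  by_contra hlt
  obtain rfl : p = 1 := by omega
  have := hRc 0
  rw [Subsingleton.elim (0 + 1 : ZMod 1) 0] at this
  exact hR _ this

variable {W : Type*} {D : Digraph V}

/-- The compatibility relation of a cover. -/
def coverRel (K : Digraph.Cover D W) (u : V) (x : W) (v : V) (y : W) : Prop :=
  x ∈ K.X u ∧ y ∈ K.X v ∧ K.H.Adj x y

theorem cover_eq_of_mem (K : Digraph.Cover D W) {u v : V} {x : W} (hu : x ∈ K.X u)
    (hv : x ∈ K.X v) : u = v := by
  by_contra h
  exact Finset.disjoint_left.1 (K.disjoint u v h) hu hv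

theorem coverRel_isCoverRel (K : Digraph.Cover D W) : CoverRel D.Adj (coverRel K) := by
  have hsub : ∀ {u x v y}, coverRel K u x v y → D.Adj u v := by
    intro u x v y h
    obtain ⟨u', v', h1, h2, h3⟩ := K.arcs x y h.2.2
    rwa [cover_eq_of_mem K h.1 h2, cover_eq_of_mem K h.2.1 h3]
  refine ⟨hsub, ?_, ?_⟩
  · intro u x x' v y h h'
    by_contra hne
    exact (K.matching u v (hsub h) (x, y) h (x', y) h' (by simp [hne])).2.2.2 rfl
  · intro u x v y y' h h'
    by_contra hne
    exact (K.matching u v (hsub h) (x, y) h (x, y') h' (by simp [hne])).1 rfl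

theorem isColorable_iff [Finite V] (K : Digraph.Cover D W) :
    K.IsColorable ↔ ∃ φ : V → W, (∀ v, φ v ∈ K.X v) ∧ Acyc (Rel (coverRel K) φ) univ := by
  constructor
  · rintro ⟨T, hT, hac⟩
    choose φ hφ _ using hT
    refine ⟨φ, fun v => (hφ v).2, ?_⟩
    by_contra hcon
    obtain ⟨p, hp, c, hc, hRc⟩ := exists_directedCycle_of_not_acyc
      (fun v h => K.independent v _ h.1 _ h.2.1 h.2.2) hcon
    have hinj : Function.Injective fun i => (⟨φ (c i), (hφ (c i)).1⟩ : T) := by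
      intro i j hij
      have h1 : φ (c i) = φ (c j) := congrArg Subtype.val hij
      exact hc (cover_eq_of_mem K (hφ (c i)).2 (h1 ▸ (hφ (c j)).2))
    let d : ZMod p → T := fun i => ⟨φ (c i), (hφ (c i)).1⟩
    -- Only the successor arcs are kept: the subdigraph need not be induced, so chords do no harm.
    refine hac ⟨range d, fun x y => ∃ i, x = d i ∧ y = d (i + 1), ?_, ?_, ?_⟩
      ⟨p, hp, Equiv.ofInjective d hinj, ?_⟩
    · rintro _ _ ⟨i, rfl, rfl⟩
      exact (hRc i).2.2
    · rintro _ _ ⟨i, rfl, rfl⟩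
      exact mem_range_self _
    · rintro _ _ ⟨i, rfl, rfl⟩
      exact mem_range_self _
    · intro i j
      change (∃ k, d i = d k ∧ d j = d (k + 1)) ↔ _
      constructor
      · rintro ⟨k, h1, h2⟩
        rw [hinj h1, hinj h2]
      · rintro rfl
        exact ⟨i, rfl, rfl⟩
  · rintro ⟨φ, hφ, hac⟩
    refine ⟨range φ, fun v => ⟨φ v, ⟨mem_range_self v, hφ v⟩, ?_⟩, ?_⟩
    · rintro _ ⟨⟨u, rfl⟩, hu⟩
      rw [cover_eq_of_mem K (hφ u) hu]
    · rintro C ⟨p, -, c, hc⟩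
      have hval : ∀ i, ∃ v, φ v = ((c i : C.verts) : range φ).1 := fun i => (c i).1.2
      choose d hd using hval
      obtain ⟨_, ⟨i, rfl⟩, h⟩ := hac (range d) (subset_univ _) ⟨d 0, 0, rfl⟩
      refine h (d (i + 1)) ⟨i + 1, rfl⟩ ⟨hφ _, hφ _, ?_⟩
      rw [hd, hd]
      exact C.adj_sub ((hc i (i + 1)).2 rfl)

theorem max_degree_le_iff (D : Digraph V) (v : V) (n : ℕ) :
    max (D.outDegree v) (D.inDegree v) ≤ n ↔
      outdeg D.Adj univ v ≤ n ∧ outdeg (fun a b => D.Adj b a) univ v ≤ n := by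
  rw [max_le_iff]
  simp [outdeg, Digraph.outDegree, Digraph.inDegree, Digraph.outNeighbors, Digraph.inNeighbors]

theorem exists_uncolorable_of_not_colorable {V : Type u} [Finite V] {D : Digraph V}
    (h : ¬ Digraph.IsDPDegreeColorable.{u, w} D) : ∃ α : Type w, Uncolorable D.Adj α univ := by
  unfold Digraph.IsDPDegreeColorable Digraph.IsDPColorable at h
  push Not at h
  obtain ⟨W, K, hK, hcol⟩ := h
  refine ⟨W, K.X, coverRel K, coverRel_isCoverRel K,
    fun v _ => (max_degree_le_iff D v _).1 (hK v), fun φ hφ hac => hcol ?_⟩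
  exact (isColorable_iff K).2 ⟨φ, fun v => hφ v (mem_univ v), hac⟩

open Classical in
/-- The cover given by lists and a compatibility relation; `e` provides the vertices of the covering
digraph. -/
noncomputable def toCover {V α W : Type*} {D : Digraph V} (hD : D.Loopless) {X : V → Finset α}
    {A : V → α → V → α → Prop} (hA : CoverRel D.Adj A) [Fintype W]
    (e : W ≃ {p : V × α // p.2 ∈ X p.1}) : Digraph.Cover D W where
  X v := {z | (e z).1.1 = v}
  H := ⟨fun z z' => A (e z).1.1 (e z).1.2 (e z').1.1 (e z').1.2⟩
  disjoint u v huv := by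
    rw [Finset.disjoint_left]
    intro z hz hz'
    rw [Finset.mem_filter] at hz hz'
    exact huv (hz.2.symm.trans hz'.2)
  exhaust z := ⟨(e z).1.1, by simp⟩
  independent v x hx y hy h := by
    rw [Finset.mem_filter] at hx hy
    have := hA.sub h
    rw [hx.2, hy.2] at this
    exact hD v this
  matching u v huv := by
    have hne : u ≠ v := by rintro rfl; exact hD u huv
    have hext : ∀ z z' : W, (e z).1.1 = (e z').1.1 → (e z).1.2 = (e z').1.2 → z = z' := by
      intro z z' h1 h2
      apply e.injective
      exact Subtype.ext (Prod.ext h1 h2)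
    rintro ⟨a, b⟩ ⟨ha, hb, hab⟩ ⟨a', b'⟩ ⟨ha', hb', hab'⟩ hneq
    simp only [Finset.coe_filter, Finset.mem_univ, true_and, mem_ofPred_eq] at ha hb ha' hb'
    have hab2 : A (e a).1.1 (e a).1.2 (e b).1.1 (e b).1.2 := hab
    have hab2' : A (e a').1.1 (e a').1.2 (e b').1.1 (e b').1.2 := hab'
    rw [ha, hb] at hab2
    rw [ha', hb'] at hab2'
    have hiff : a = a' ↔ b = b' := by
      constructor
      · rintro rfl
        exact hext _ _ (hb.trans hb'.symm) (hA.injr hab2 hab2')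
      · rintro rfl
        exact hext _ _ (ha.trans ha'.symm) (hA.injl hab2 hab2')
    have h1 : a ≠ a' := fun h => hneq (by rw [h, hiff.1 h])
    refine ⟨h1, ?_, ?_, fun h => h1 (hiff.2 h)⟩
    · rintro rfl
      exact hne (ha.symm.trans hb')
    · rintro rfl
      exact hne (ha'.symm.trans hb)
  arcs x y h := ⟨(e x).1.1, (e y).1.1, hA.sub h, by simp, by simp⟩

theorem not_colorable_of_uncolorable {V : Type u} [Finite V] {D : Digraph V} (hD : D.Loopless)
    {α : Type} (h : Uncolorable D.Adj α univ) : ¬ Digraph.IsDPDegreeColorable.{u, w} D := by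
  classical
  obtain ⟨X, A, hA, hX, hun⟩ := h
  have : Finite {p : V × α // p.2 ∈ X p.1} := Finite.of_injective
    (β := (v : V) × X v) (fun p => ⟨p.1.1, p.1.2, p.2⟩) fun p q h => by
      obtain ⟨⟨a, x⟩, hx⟩ := p
      obtain ⟨⟨b, y⟩, hy⟩ := q
      obtain rfl : a = b := congrArg Sigma.fst h
      simpa using h
  -- The cover needs a vertex type in universe w; finiteness allows a lifted `Fin`.
  let e : ULift.{w} (Fin (Nat.card {p : V × α // p.2 ∈ X p.1})) ≃ {p : V × α // p.2 ∈ X p.1} :=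
    Equiv.ulift.trans (Finite.equivFin _).symm
  intro hcol
  have hmem : ∀ v z, z ∈ (toCover hD hA e).X v ↔ (e z).1.1 = v := fun v z => by
    simp [toCover]
  have hle : ∀ v, (X v).card ≤ ((toCover hD hA e).X v).card := by
    intro v
    rw [← Finset.card_attach]
    refine Finset.card_le_card_of_injOn (fun x => e.symm ⟨(v, x), x.2⟩) ?_ ?_
    · intro x _
      exact (hmem _ _).2 (by simp)
    · intro x _ y _ hxy
      have := e.symm.injective hxy
      rw [Subtype.mk.injEq, Prod.mk.injEq] at this
      exact Subtype.ext this.2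
  obtain ⟨φ, hφ, hac⟩ := (isColorable_iff _).1
    (hcol _ (toCover hD hA e) fun v =>
      (max_degree_le_iff D v _).2
        ((hX v (mem_univ v)).imp (fun h => h.trans (hle v)) fun h => h.trans (hle v)))
  have hφ1 : ∀ v, (e (φ v)).1.1 = v := fun v => (hmem _ _).1 (hφ v)
  refine hun (fun v => (e (φ v)).1.2) (fun v _ => ?_) (hac.congr fun a _ b _ hab => ?_)
  · have h1 := (e (φ v)).2
    rwa [hφ1 v] at h1
  · refine ⟨hφ a, hφ b, ?_⟩
    change A (e (φ a)).1.1 _ (e (φ b)).1.1 _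
    rw [hφ1 a, hφ1 b]
    exact hab

end Bridges

end DPDegree

theorem mainTheorem2 {V : Type u} [Finite V] (D : Digraph V) (hD : D.Loopless)
    (hconn : D.IsConnected) :
    ¬ Digraph.IsDPDegreeColorable.{u, w} D ↔
      ∀ B : Digraph.Subdigraph D, D.IsBlock B →
        B.toDigraph.IsDirectedCycle ∨ B.toDigraph.IsBidirectedCycle ∨
          B.toDigraph.IsBidirectedComplete := by
  obtain ⟨hpre, hne⟩ := (SimpleGraph.connected_iff _).1 hconn
  have hcut := (DPDegree.inclusive_preconnected_iff D).1 hpre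
  have huniv : (Set.univ : Set V).Nonempty := Set.univ_nonempty
  rw [DPDegree.forall_block_iff]
  constructor
  · intro h
    obtain ⟨α, hα⟩ := DPDegree.exists_uncolorable_of_not_colorable h
    exact DPDegree.brick_of_uncolorable hD _ _ rfl huniv hcut hα
  · intro h
    obtain ⟨α, hα⟩ := DPDegree.uncolorable_of_bricks hD _ _ rfl huniv hcut h
    exact DPDegree.not_colorable_of_uncolorable hD hα
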